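/- **Theorem 4.1 (Unstable foliation).** Setting. Let $1<\alpha<2$, $d\ge 0$, and let $\mathbb P$ be the law, on the space $D$ of càdlàg paths $\omega:\mathbb R\to\mathbb R$ with $\omega(0)=0$ (with the $\sigma$-algebra generated by the evaluations), of a two-sided scalar symmetric $\alpha$-stable Lévy motion with zero drift and diffusion coefficient $d$: increments are independent, and $\mathbb E\,e^{iu(\omega(t)-\omega(s))}=e^{-(t-s)(d u^2/2+|u|^\alpha)}$ for $s\le t$, $u\in\mathbb R$ (pure $\alpha$-stable motion is $d=0$). Put $\theta_t\omega=\omega(\cdot+t)-\omega(t)$, $\Omega=\{\omega\in D:\ \omega(t)/t\to0 \text{ as } t\to\pm\infty\}$ and $z(\omega)=-\int_{-\infty}^0e^{\tau}\omega(\tau)\,d\tau$. Let $A\in\mathbb R^{n\times n}$, $B\in\mathbb R^{m\times m}$, $f:\mathbb R^n\times\mathbb R^m\to\mathbb R^n$, $g:\mathbb R^n\times\mathbb R^m\to\mathbb R^m$, and let $|\cdot|$ be the Euclidean norm. Assume * **A1.** $b<0<a$, $|e^{At}x|\le e^{at}|x|$ for $t\le0$, and $|e^{Bt}y|\le e^{bt}|y|$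 for $t\ge0$; * **A2.** $f(0,0)=0$, $g(0,0)=0$, and for some $K>0$ both $f$ and $g$ satisfy $|h(x_1,y_1)-h(x_2,y_2)|\le K(|x_1-x_2|+|y_1-y_2|)$ for all arguments; * $0<\eta<a$ and $K\left(\frac1{\eta-b}+\frac1{a-\eta}\right)<1$. With $F(x,y,\omega)=e^{-z(\omega)}f(e^{z(\omega)}x,e^{z(\omega)}y)$ and $G(x,y,\omega)=e^{-z(\omega)}g(e^{z(\omega)}x,e^{z(\omega)}y)$, consider the random system $$\hat x'=A\hat x+F(\hat x,\hat y,\theta_t\omega)+z(\theta_t\omega)\hat x,\qquad \hat y'=B\hat y+G(\hat x,\hat y,\theta_t\omega)+z(\theta_t\omega)\hat y,$$ whose solutions are understood in the sense of Carathéodory on all of $\mathbb R$; let $\varphi(t,\omega,p_0)$ be the solution with value $p_0$ at time $0$. Let $C_\eta^-$ (depending on $\omega$) be the space of continuous functions $\phi$ on $(-\infty,0]$ with values in $\mathbb R^n\times\mathbb R^m$ and $\sup_{t\le0}e^{-\eta t-\int_0^tz(\theta_\tau\omega)d\tau}|\phi(t)|<\infty$, and let $$\mathcal W_\eta(p_0,\omega)=\{q\in\mathbb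 R^n\times\mathbb R^m:\ \varphi(\cdot,\omega,p_0)-\varphi(\cdot,\omega,q)\in C_\eta^-\}.$$ Claim. $\theta_t\Omega=\Omega$ for all $t\in\mathbb R$, $\mathbb P(\Omega)=1$, and for every $\omega\in\Omega$: 1. For every $p_0$ the random system has exactly one solution on $\mathbb R$ with value $p_0$ at time $0$. 2. The sets $\mathcal W_\eta(p_0,\omega)$ form a partition of $\mathbb R^n\times\mathbb R^m$ (with $p_0\in\mathcal W_\eta(p_0,\omega)$), and any two points $q,q'$ of the same fiber satisfy $|\varphi(t,\omega,q)-\varphi(t,\omega,q')|=O(e^{\eta t})$ as $t\to-\infty$. 3. For every $p_0=(\hat x_0,\hat y_0)$ and $u_0\in\mathbb R^n$ there is exactly one $(u,v)\in C_\eta^-$ with, for all $t\le0$, $$u(t)=e^{At+\int_0^tz(\theta_\tau\omega)d\tau}u_0+\int_0^te^{A(t-s)+\int_s^tz(\theta_\tau\omega)d\tau}\Delta F(s)\,ds,\qquad v(t)=\int_{-\infty}^te^{B(t-s)+\int_s^tz(\theta_\tau\omega)d\tau}\Delta G(s)\,ds,$$ where, with $(\hat x(s),\hat y(s))=\varphi(s,\omega,p_0)$,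 $\Delta F(s)=F(u(s)+\hat x(s),v(s)+\hat y(s),\theta_s\omega)-F(\hat x(s),\hat y(s),\theta_s\omega)$, and $\Delta G$ is defined in the same way from $G$. 4. Every fiber is a graph, $\mathcal W_\eta((\hat x_0,\hat y_0),\omega)=\{(\xi,l(\xi,(\hat x_0,\hat y_0),\omega)):\ \xi\in\mathbb R^n\}$, where $$l(\xi,(\hat x_0,\hat y_0),\omega)=\hat y_0+\int_{-\infty}^0e^{-Bs+\int_s^0z(\theta_\tau\omega)d\tau}\Delta G(s)\,ds$$ with $(u,v)$ the solution in 3 for $u_0=\xi-\hat x_0$, and $l$ is Lipschitz in $\xi$ with $$\operatorname{Lip} l\le\frac{K}{(\eta-b)\left(1-K\left(\frac1{\eta-b}+\frac1{a-\eta}\right)\right)}.$$ -/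

import Mathlib

open Set Filter Topology MeasureTheory ProbabilityTheory

noncomputable section

namespace LevyFoliation

/-! ### The canonical path space of a two-sided scalar Lévy motion -/

/-- A real path on the whole line is càdlàg: right-continuous with left limits. -/
def IsCadlag (w : ℝ → ℝ) : Prop :=
  ∀ t : ℝ, ContinuousWithinAt w (Ici t) t ∧ ∃ c : ℝ, Tendsto w (𝓝[<] t) (𝓝 c)

/-- The space `D(ℝ, ℝ)` of càdlàg paths on `ℝ` that vanish at time `0`. -/
def PathSpace : Type := {w : ℝ → ℝ // IsCadlag w ∧ w 0 = 0}

instance : CoeFun PathSpace (fun _ => ℝ → ℝ) := ⟨Subtype.val⟩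

/-- The σ-algebra on path space generated by the evaluations `ω ↦ ω t`, which is the Borel σ-algebra
of the Skorokhod topology. -/
instance : MeasurableSpace PathSpace :=
  MeasurableSpace.comap Subtype.val (MeasurableSpace.pi : MeasurableSpace (ℝ → ℝ))

theorem isCadlag_shift {w : ℝ → ℝ} (hw : IsCadlag w) (t : ℝ) :
    IsCadlag (fun s => w (s + t) - w t) := by
  intro s
  obtain ⟨h1, c, h2⟩ := hw (s + t)
  refine ⟨?_, c - w t, ?_⟩
  · refine ContinuousWithinAt.sub ?_ continuousWithinAt_const
    refine ContinuousWithinAt.comp (t := Ici (s + t)) (f := fun r : ℝ => r + t) h1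
      (by fun_prop) ?_
    intro r hr
    simp only [mem_Ici] at hr ⊢
    linarith
  · refine Tendsto.sub ?_ tendsto_const_nhds
    refine h2.comp ?_
    refine tendsto_nhdsWithin_of_tendsto_nhds_of_eventually_within _ ?_ ?_
    · exact ((continuous_id.add continuous_const).tendsto s).mono_left nhdsWithin_le_nhds
    · filter_upwards [self_mem_nhdsWithin] with r hr
      simp only [mem_Iio] at hr ⊢
      linarith

/-- The Wiener shift `θ_t ω = ω(· + t) - ω(t)`. -/
def shift (t : ℝ) (ω : PathSpace) : PathSpace :=
  ⟨fun s => ω (s + t) - ω t, isCadlag_shift ω.2.1 t, by simp⟩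

/-- `P` is the law on path space of a two-sided symmetric `α`-stable Lévy motion with zero drift,
Gaussian coefficient `d` (pure `α`-stable motion is `d = 0`) and the Lévy measure
`c_α |x|^{-1-α} dx`, normalized such that its contribution to the characteristic exponent is
`|u|^α`: the increments are independent, and `ω(t) - ω(s)`, `s ≤ t`, has the characteristic
function `u ↦ exp (-(t - s) (d u² / 2 + |u|^α))`. -/
structure IsStableLevyLaw (α d : ℝ) (P : Measure PathSpace) : Prop where
  prob : IsProbabilityMeasure P
  indep : HasIndepIncrements (fun (t : ℝ) (ω : PathSpace) => ω t) P
  law : ∀ s t : ℝ, s ≤ t → ∀ u : ℝ,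
    charFun (P.map (fun ω : PathSpace => ω t - ω s)) u
      = Complex.exp ((-(t - s) * (d * u ^ 2 / 2 + |u| ^ α) : ℝ) : ℂ)

/-- The set `Ω` of the càdlàg paths of sublinear growth, `ω(t) / t → 0` as `t → ±∞`. -/
def Omega : Set PathSpace :=
  {ω | Tendsto (fun t : ℝ => ω t / t) atTop (𝓝 0) ∧ Tendsto (fun t : ℝ => ω t / t) atBot (𝓝 0)}

/-- The random variable `z(ω) = -∫_{-∞}^0 e^τ ω(τ) dτ`; `t ↦ z(θ_t ω)` is the stationary solution
of the Langevin equation `dz = -z dt + dL`. -/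
def z (ω : PathSpace) : ℝ := -∫ τ in Iic (0 : ℝ), Real.exp τ * ω τ

/-- `∫_s^t z(θ_τ ω) dτ`. -/
def zInt (ω : PathSpace) (s t : ℝ) : ℝ := ∫ τ in s..t, z (shift τ ω)

/-! ### The random differential system -/

/-- `ℝⁿ` with the Euclidean norm. -/
abbrev E (n : ℕ) : Type := EuclideanSpace ℝ (Fin n)

/-- The data of the stochastic system `dx = (Ax + f(x,y)) dt + x ⋄ dL`,
`dy = (By + g(x,y)) dt + y ⋄ dL` on `ℝⁿ × ℝᵐ`. -/
structure Data (n m : ℕ) where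
  A : E n →L[ℝ] E n
  B : E m →L[ℝ] E m
  f : E n → E m → E n
  g : E n → E m → E m

namespace Data

variable {n m : ℕ} (S : Data n m)

/-- Exponential dichotomy with exponents `b < 0 < a`. -/
structure Dichotomy (a b : ℝ) : Prop where
  b_neg : b < 0
  a_pos : 0 < a
  bound_A : ∀ t : ℝ, t ≤ 0 → ∀ x : E n, ‖NormedSpace.exp (t • S.A) x‖ ≤ Real.exp (a * t) * ‖x‖
  bound_B : ∀ t : ℝ, 0 ≤ t → ∀ y : E m, ‖NormedSpace.exp (t • S.B) y‖ ≤ Real.exp (b * t) * ‖y‖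

/-- The nonlinearities vanish at the origin and are Lipschitz with constant `K > 0`. -/
structure LipschitzCond (K : ℝ) : Prop where
  K_pos : 0 < K
  f_zero : S.f 0 0 = 0
  g_zero : S.g 0 0 = 0
  f_lip : ∀ x₁ x₂ y₁ y₂, ‖S.f x₁ y₁ - S.f x₂ y₂‖ ≤ K * (‖x₁ - x₂‖ + ‖y₁ - y₂‖)
  g_lip : ∀ x₁ x₂ y₁ y₂, ‖S.g x₁ y₁ - S.g x₂ y₂‖ ≤ K * (‖x₁ - x₂‖ + ‖y₁ - y₂‖)

/-- `F(x, y, ω) = e^{-z(ω)} f(e^{z(ω)} x, e^{z(ω)} y)`. -/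
def F (x : E n) (y : E m) (ω : PathSpace) : E n :=
  Real.exp (-z ω) • S.f (Real.exp (z ω) • x) (Real.exp (z ω) • y)

/-- `G(x, y, ω) = e^{-z(ω)} g(e^{z(ω)} x, e^{z(ω)} y)`. -/
def G (x : E n) (y : E m) (ω : PathSpace) : E m :=
  Real.exp (-z ω) • S.g (Real.exp (z ω) • x) (Real.exp (z ω) • y)

/-- `p = (x, y) : ℝ → ℝⁿ × ℝᵐ` solves, on the whole time line and with initial value `p₀` at time
`0`, the random system `x' = A x + F(x, y, θ_t ω) + z(θ_t ω) x`,
`y' = B y + G(x, y, θ_t ω) + z(θ_t ω) y` in the sense of Carathéodory. -/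
structure IsSolution (ω : PathSpace) (p₀ : E n × E m) (p : ℝ → E n × E m) : Prop where
  cont : Continuous p
  integrable_x : ∀ t : ℝ, IntervalIntegrable
    (fun s => S.A (p s).1 + S.F (p s).1 (p s).2 (shift s ω) + z (shift s ω) • (p s).1) volume 0 t
  integrable_y : ∀ t : ℝ, IntervalIntegrable
    (fun s => S.B (p s).2 + S.G (p s).1 (p s).2 (shift s ω) + z (shift s ω) • (p s).2) volume 0 t
  eq_x : ∀ t : ℝ, (p t).1 = p₀.1 + ∫ s in (0 : ℝ)..t,
    (S.A (p s).1 + S.F (p s).1 (p s).2 (shift s ω) + z (shift s ω) • (p s).1)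
  eq_y : ∀ t : ℝ, (p t).2 = p₀.2 + ∫ s in (0 : ℝ)..t,
    (S.B (p s).2 + S.G (p s).1 (p s).2 (shift s ω) + z (shift s ω) • (p s).2)

/-- The solution operator `φ(t, ω, p₀)` of the random system: the value at time `t` of the solution
with initial value `p₀`. -/
def flow (t : ℝ) (ω : PathSpace) (p₀ : E n × E m) : E n × E m :=
  Classical.epsilon (S.IsSolution ω p₀) t

end Data

/-! ### Unstable fibers -/

/-- `φ`, restricted to `(-∞, 0]`, belongs to the space `C_η^-` of continuous functions with
`sup_{t ≤ 0} e^{-η t - ∫_0^t z(θ_τ ω) dτ} |φ(t)| < ∞`. -/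
def MemCminus {k : ℕ} (η : ℝ) (ω : PathSpace) (φ : ℝ → E k) : Prop :=
  ContinuousOn φ (Iic 0) ∧
    BddAbove ((fun t : ℝ => Real.exp (-η * t - zInt ω 0 t) * ‖φ t‖) '' Iic 0)

namespace Data

variable {n m : ℕ} (S : Data n m)

/-- The fiber `W_η(p₀, ω)`: all initial values `q` for which the difference
`φ(·, ω, p₀) - φ(·, ω, q)` lies in `C_η^-`. -/
def fiber (η : ℝ) (p₀ : E n × E m) (ω : PathSpace) : Set (E n × E m) :=
  {q | MemCminus η ω (fun t => (S.flow t ω p₀ - S.flow t ω q).1) ∧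
       MemCminus η ω (fun t => (S.flow t ω p₀ - S.flow t ω q).2)}

/-- A set `W` of initial values is (contained in) an `η`-unstable fiber over `ω` if any two orbits
starting in it satisfy `|φ(t, ω, q) - φ(t, ω, q')| = O(e^{η t})` as `t → -∞`. -/
def IsUnstableFiber (η : ℝ) (ω : PathSpace) (W : Set (E n × E m)) : Prop :=
  ∀ q ∈ W, ∀ q' ∈ W,
    (fun t : ℝ => S.flow t ω q - S.flow t ω q') =O[atBot] (fun t : ℝ => Real.exp (η * t))

/-- `ΔF(u, v, θ_s ω)`, the increment of `F` along the reference orbit through `p₀`. -/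
def deltaF (ω : PathSpace) (p₀ : E n × E m) (s : ℝ) (u : E n) (v : E m) : E n :=
  S.F (u + (S.flow s ω p₀).1) (v + (S.flow s ω p₀).2) (shift s ω)
    - S.F (S.flow s ω p₀).1 (S.flow s ω p₀).2 (shift s ω)

/-- `ΔG(u, v, θ_s ω)`, the increment of `G` along the reference orbit through `p₀`. -/
def deltaG (ω : PathSpace) (p₀ : E n × E m) (s : ℝ) (u : E n) (v : E m) : E m :=
  S.G (u + (S.flow s ω p₀).1) (v + (S.flow s ω p₀).2) (shift s ω)
    - S.G (S.flow s ω p₀).1 (S.flow s ω p₀).2 (shift s ω)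

/-- `φ = (u, v) ∈ C_η^-` solves the Lyapunov–Perron integral system with parameter `u₀`:
for all `t ≤ 0`,
`u(t) = e^{At + ∫_0^t z} u₀ + ∫_0^t e^{A(t-s) + ∫_s^t z} ΔF(u(s), v(s), θ_s ω) ds` and
`v(t) = ∫_{-∞}^t e^{B(t-s) + ∫_s^t z} ΔG(u(s), v(s), θ_s ω) ds`.
Only the values of `φ` on `(-∞, 0]` matter. -/
structure IsLPSolution (η : ℝ) (ω : PathSpace) (p₀ : E n × E m) (u₀ : E n)
    (φ : ℝ → E n × E m) : Prop where
  mem_u : MemCminus η ω (fun t => (φ t).1)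
  mem_v : MemCminus η ω (fun t => (φ t).2)
  integrable_u : ∀ t : ℝ, t ≤ 0 → IntervalIntegrable (fun s => Real.exp (zInt ω s t) •
    NormedSpace.exp ((t - s) • S.A) (S.deltaF ω p₀ s (φ s).1 (φ s).2)) volume 0 t
  integrable_v : ∀ t : ℝ, t ≤ 0 → IntegrableOn (fun s => Real.exp (zInt ω s t) •
    NormedSpace.exp ((t - s) • S.B) (S.deltaG ω p₀ s (φ s).1 (φ s).2)) (Iic t) volume
  eq_u : ∀ t : ℝ, t ≤ 0 → (φ t).1 = Real.exp (zInt ω 0 t) • NormedSpace.exp (t • S.A) u₀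
    + ∫ s in (0 : ℝ)..t, Real.exp (zInt ω s t) •
        NormedSpace.exp ((t - s) • S.A) (S.deltaF ω p₀ s (φ s).1 (φ s).2)
  eq_v : ∀ t : ℝ, t ≤ 0 → (φ t).2 = ∫ s in Iic t, Real.exp (zInt ω s t) •
        NormedSpace.exp ((t - s) • S.B) (S.deltaG ω p₀ s (φ s).1 (φ s).2)

/-- The solution `φ(·, ω, p₀; u₀)` of the Lyapunov–Perron system. -/
def lpSolution (η : ℝ) (ω : PathSpace) (p₀ : E n × E m) (u₀ : E n) : ℝ → E n × E m :=
  Classical.epsilon (S.IsLPSolution η ω p₀ u₀)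

/-- The graph map `l(ξ, (x₀, y₀), ω) = y₀ + ∫_{-∞}^0 e^{-Bs + ∫_s^0 z} ΔG(u(s), v(s), θ_s ω) ds`
with `(u, v) = φ(·, ω, (x₀, y₀); ξ - x₀)`. -/
def l (η : ℝ) (ξ : E n) (p₀ : E n × E m) (ω : PathSpace) : E m :=
  p₀.2 + ∫ s in Iic (0 : ℝ), Real.exp (zInt ω s 0) • NormedSpace.exp ((-s) • S.B)
    (S.deltaG ω p₀ s (S.lpSolution η ω p₀ (ξ - p₀.1) s).1 (S.lpSolution η ω p₀ (ξ - p₀.1) s).2)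

end Data

end LevyFoliation

end

noncomputable section

namespace LevyFoliation

set_option linter.unusedSectionVars false

/-! The argument is pathwise; probability enters only in `P(Ω) = 1`. Along a path of sublinear
growth, `t ↦ z(θ_t ω)` is right-continuous and locally bounded, so `e^{-∫_0^t z}` is an admissible
integrating factor. It removes the terms `z x`, `z y`; since `e^{-c} f(e^c ·)` is as Lipschitz as
`f`, there remains a deterministic system `u' = A u + h`, `v' = B v + k`, still `K`-Lipschitz, zero
at the origin and right-continuous in time (`LipschitzCond.transformed`). The weight of `C_η^-`
becomes plain `e^{ηt}` decay.

In these coordinates a point lies in the fiber of `p₀` iff the difference of the two orbits decays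
like `e^{ηt}` at `-∞`. Differences solve a system of the same type. For decaying curves on `(-∞, 0]`
that system is equivalent to the Lyapunov–Perron equations (`IsOrbitOn.isLP`, `IsLP.isOrbitOn`):
vary constants from `0` in `u` and from `-∞` in `v`, where `b < η` kills the boundary term. In the
`e^{ηt}`-weighted sum norm their right-hand side contracts with constant `κ = K (1/(η-b) + 1/(a-η))
< 1`. Hence each `u(0)` belongs to exactly one decaying difference, which makes the fiber a graph
(`mem_fiber_iff_eq_l`); estimating `v(0)` gives the Lipschitz constant.

The rate `O(e^{ηt})` in the original coordinates needs more, because `∫_0^t z` is only `o(|t|)`. The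
gap condition is open, so it holds for some `η' > η`. The `η'`-fiber is contained in the `η`-fiber
and both are graphs over all of `ℝⁿ`, so they coincide, and the surplus `η' - η` absorbs `e^{∫ z}`
(`isUnstableFiber_fiber`).

For `P(Ω) = 1`, the characteristic function bounds the probability that an increment over time `2^k`
exceeds `ε 2^k` by a multiple of `2^{k(1-α)}`. This is summable since `α > 1`; Ottaviani's
inequality extends the bound to whole time blocks, and Borel–Cantelli concludes. -/

/-! ### Right-continuous, locally bounded functions -/

/-- A function on the line that is right-continuous and bounded on bounded sets. -/
structure Tame {V : Type*} [NormedAddCommGroup V] (g : ℝ → V) : Prop where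
  rightCont : ∀ t, ContinuousWithinAt g (Ici t) t
  locBdd : ∀ R : ℝ, ∃ C : ℝ, ∀ s : ℝ, |s| ≤ R → ‖g s‖ ≤ C

/-- Sample `f` at the first point of the grid `ℤ/(n+1)` strictly to the right of `t`. Each sampled
function factors through the integer floor, hence is measurable, and right-continuity gives
pointwise convergence. -/
theorem measurable_of_rightCont {X : Type*} [TopologicalSpace X] [TopologicalSpace.PseudoMetrizableSpace X]
    [MeasurableSpace X] [BorelSpace X] {f : ℝ → X} (hf : ∀ t, ContinuousWithinAt f (Ici t) t) :
    Measurable f := by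
  have key : ∀ t : ℝ, Tendsto (fun n : ℕ => ((⌊((n : ℝ) + 1) * t⌋ : ℝ) + 1) / ((n : ℝ) + 1)) atTop
      (𝓝[Ici t] t) := by
    intro t
    have hpos : ∀ n : ℕ, (0 : ℝ) < (n : ℝ) + 1 := fun n => by positivity
    have hge : ∀ n : ℕ, t ≤ ((⌊((n : ℝ) + 1) * t⌋ : ℝ) + 1) / ((n : ℝ) + 1) := by
      intro n
      rw [le_div_iff₀ (hpos n)]
      have := (Int.lt_floor_add_one (((n : ℝ) + 1) * t)).le
      linarith
    have hle : ∀ n : ℕ, ((⌊((n : ℝ) + 1) * t⌋ : ℝ) + 1) / ((n : ℝ) + 1) ≤ t + 1 / ((n : ℝ) + 1) := by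
      intro n
      have h1 : (t + 1 / ((n : ℝ) + 1)) * ((n : ℝ) + 1) = ((n : ℝ) + 1) * t + 1 := by
        have := (hpos n).ne'
        field_simp
      rw [div_le_iff₀ (hpos n), h1]
      linarith [Int.floor_le (((n : ℝ) + 1) * t)]
    refine tendsto_nhdsWithin_iff.2 ⟨?_, Eventually.of_forall hge⟩
    refine tendsto_of_tendsto_of_tendsto_of_le_of_le tendsto_const_nhds ?_ hge hle
    simpa using (tendsto_const_nhds (x := t)).add tendsto_one_div_add_atTop_nhds_zero_nat
  refine measurable_of_tendsto_metrizable (f := fun (n : ℕ) t =>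
    f (((⌊((n : ℝ) + 1) * t⌋ : ℝ) + 1) / ((n : ℝ) + 1))) ?_ ?_
  · intro n
    exact (measurable_from_top (f := fun k : ℤ => f (((k : ℝ) + 1) / ((n : ℝ) + 1)))).comp
      (Int.measurable_floor.comp (by fun_prop))
  · rw [tendsto_pi_nhds]
    intro t
    exact (hf t).tendsto.comp (key t)

section Tame

variable {V W : Type*} [NormedAddCommGroup V] [NormedAddCommGroup W]

theorem _root_.Continuous.tame {g : ℝ → V} (hg : Continuous g) : Tame g where
  rightCont t := hg.continuousWithinAt
  locBdd R := by
    obtain ⟨C, hC⟩ := (isCompact_Icc (a := -R) (b := R)).exists_bound_of_continuousOn hg.continuousOn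
    exact ⟨C, fun s hs => hC s (abs_le.1 hs)⟩

theorem Tame.of_norm_le {g : ℝ → V} (hg : ∀ t, ContinuousWithinAt g (Ici t) t) {m : ℝ → ℝ}
    (hm : Tame m) (hle : ∀ t, ‖g t‖ ≤ m t) : Tame g where
  rightCont := hg
  locBdd R := by
    obtain ⟨C, hC⟩ := hm.locBdd R
    exact ⟨C, fun s hs => (hle s).trans ((le_abs_self _).trans (hC s hs))⟩

theorem Tame.norm {g : ℝ → V} (hg : Tame g) : Tame (fun t => ‖g t‖) where
  rightCont t := (hg.rightCont t).norm
  locBdd R := by simpa using hg.locBdd R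

theorem Tame.add {g h : ℝ → V} (hg : Tame g) (hh : Tame h) : Tame (fun t => g t + h t) where
  rightCont t := (hg.rightCont t).add (hh.rightCont t)
  locBdd R := by
    obtain ⟨C, hC⟩ := hg.locBdd R
    obtain ⟨D, hD⟩ := hh.locBdd R
    exact ⟨C + D, fun s hs => (norm_add_le _ _).trans (add_le_add (hC s hs) (hD s hs))⟩

theorem Tame.neg {g : ℝ → V} (hg : Tame g) : Tame (fun t => - g t) where
  rightCont t := (hg.rightCont t).neg
  locBdd R := by simpa using hg.locBdd R

theorem Tame.sub {g h : ℝ → V} (hg : Tame g) (hh : Tame h) : Tame (fun t => g t - h t) := by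
  simpa only [sub_eq_add_neg] using hg.add hh.neg

theorem Tame.mul {g h : ℝ → ℝ} (hg : Tame g) (hh : Tame h) : Tame (fun t => g t * h t) where
  rightCont t := (hg.rightCont t).mul (hh.rightCont t)
  locBdd R := by
    obtain ⟨C, hC⟩ := hg.locBdd R
    obtain ⟨D, hD⟩ := hh.locBdd R
    refine ⟨C * D, fun s hs => ?_⟩
    rw [norm_mul]
    exact mul_le_mul (hC s hs) (hD s hs) (norm_nonneg _) ((norm_nonneg _).trans (hC s hs))

variable [NormedSpace ℝ V] [NormedSpace ℝ W]

theorem Tame.smul {c : ℝ → ℝ} {g : ℝ → V} (hc : Tame c) (hg : Tame g) :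
    Tame (fun t => c t • g t) :=
  Tame.of_norm_le (fun t => (hc.rightCont t).smul (hg.rightCont t)) (hc.norm.mul hg.norm)
    fun _ => (norm_smul _ _).le

theorem Tame.clm_apply {L : ℝ → V →L[ℝ] W} {g : ℝ → V} (hL : Tame L) (hg : Tame g) :
    Tame (fun t => L t (g t)) :=
  Tame.of_norm_le (fun t => (hL.rightCont t).clm_apply (hg.rightCont t)) (hL.norm.mul hg.norm)
    fun _ => ContinuousLinearMap.le_opNorm _ _

theorem Tame.stronglyMeasurable [SecondCountableTopology V] {g : ℝ → V} (hg : Tame g) :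
    StronglyMeasurable g := by
  borelize V
  exact (measurable_of_rightCont hg.rightCont).stronglyMeasurable

theorem Tame.intervalIntegrable [SecondCountableTopology V] {g : ℝ → V} (hg : Tame g) (a b : ℝ) :
    IntervalIntegrable g volume a b := by
  obtain ⟨C, hC⟩ := hg.locBdd (max |a| |b|)
  rw [intervalIntegrable_iff]
  refine Measure.integrableOn_of_bounded (M := C) (by simp)
    hg.stronglyMeasurable.aestronglyMeasurable ?_
  refine (ae_restrict_iff' measurableSet_uIoc).2 (Eventually.of_forall fun s hs => hC s ?_)
  rcases mem_uIcc.1 (uIoc_subset_uIcc hs) with h | h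
  · exact abs_le_max_abs_abs h.1 h.2
  · exact (abs_le_max_abs_abs h.1 h.2).trans_eq (max_comm _ _)

theorem Tame.continuous_integral [SecondCountableTopology V] {g : ℝ → V} (hg : Tame g) (c : ℝ) :
    Continuous fun u => ∫ r in c..u, g r :=
  intervalIntegral.continuous_primitive hg.intervalIntegrable c

theorem Tame.hasDerivWithinAt_integral [SecondCountableTopology V] [CompleteSpace V] {g : ℝ → V}
    (hg : Tame g) (c t : ℝ) : HasDerivWithinAt (fun u => ∫ r in c..u, g r) (g t) (Ici t) t :=
  intervalIntegral.integral_hasDerivWithinAt_right (hg.intervalIntegrable c t)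
    (hg.stronglyMeasurable.stronglyMeasurableAtFilter)
    ((hg.rightCont t).mono Ioi_subset_Ici_self)

/-- At a jump of the integrand only the right derivative exists; for a continuous primitive that is
enough. All differential equations below are read in this one-sided sense. -/
theorem Tame.integral_eq_sub [SecondCountableTopology V] [CompleteSpace V] {f g : ℝ → V} {a b : ℝ}
    (hg : Tame g) (hf : Continuous f)
    (hd : ∀ x ∈ Ioo (min a b) (max a b), HasDerivWithinAt f (g x) (Ici x) x) :
    ∫ y in a..b, g y = f b - f a :=
  intervalIntegral.integral_eq_sub_of_hasDeriv_right hf.continuousOn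
    (fun x hx => (hd x hx).Ioi_of_Ici) (hg.intervalIntegrable a b)

end Tame

/-- The one-sided limits bound `w` near every point, and compactness of `[-R, R]` makes the bound
uniform. -/
theorem IsCadlag.tame {w : ℝ → ℝ} (hw : IsCadlag w) : Tame w where
  rightCont t := (hw t).1
  locBdd R := by
    have key : ∃ C, ∀ s ∈ Icc (-R) R, ‖w s‖ ≤ C := by
      refine (isCompact_Icc (a := -R) (b := R)).induction_on
        (p := fun S => ∃ C, ∀ s ∈ S, ‖w s‖ ≤ C) ⟨0, by simp⟩ ?_ ?_ ?_
      · rintro S T hST ⟨C, hC⟩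
        exact ⟨C, fun s hs => hC s (hST hs)⟩
      · rintro S T ⟨C, hC⟩ ⟨D, hD⟩
        refine ⟨max C D, ?_⟩
        rintro s (hs | hs)
        · exact (hC s hs).trans (le_max_left _ _)
        · exact (hD s hs).trans (le_max_right _ _)
      · intro t _
        obtain ⟨hr, c, hl⟩ := hw t
        have h1 : ∀ᶠ s in 𝓝[Ici t] t, ‖w s‖ ≤ ‖w t‖ + 1 :=
          (hr.tendsto.norm.eventually (gt_mem_nhds (lt_add_one _))).mono fun _ h => le_of_lt h
        have h2 : ∀ᶠ s in 𝓝[<] t, ‖w s‖ ≤ ‖c‖ + 1 :=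
          (hl.norm.eventually (gt_mem_nhds (lt_add_one _))).mono fun _ h => le_of_lt h
        have h3 : ∀ᶠ s in 𝓝 t, ‖w s‖ ≤ max (‖w t‖ + 1) (‖c‖ + 1) := by
          rw [← nhdsLT_sup_nhdsGE, eventually_sup]
          exact ⟨h2.mono fun s h => h.trans (le_max_right _ _),
            h1.mono fun s h => h.trans (le_max_left _ _)⟩
        exact ⟨_, mem_nhdsWithin_of_mem_nhds h3, _, fun s hs => hs⟩
    obtain ⟨C, hC⟩ := key
    exact ⟨C, fun s hs => hC s (abs_le.1 hs)⟩

/-! ### Variation of constants -/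

section Semigroup

variable {V : Type*} [NormedAddCommGroup V] [NormedSpace ℝ V] [CompleteSpace V]

local notation "𝔢" => NormedSpace.exp

theorem exp_smul_continuous (A : V →L[ℝ] V) : Continuous fun t : ℝ => 𝔢 (t • A) :=
  continuous_iff_continuousAt.2 fun t => (hasDerivAt_exp_smul_const (𝕂 := ℝ) A t).continuousAt

theorem exp_add_smul_apply (A : V →L[ℝ] V) (s t : ℝ) (x : V) :
    𝔢 ((s + t) • A) x = 𝔢 (s • A) (𝔢 (t • A) x) := by
  let _ : NormedAlgebra ℚ (V →L[ℝ] V) := NormedAlgebra.restrictScalars ℚ ℝ _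
  rw [add_smul, NormedSpace.exp_add_of_commute
    ((Commute.refl A).smul_left s |>.smul_right t)]
  rfl

theorem exp_sub_smul_apply (A : V →L[ℝ] V) (t s : ℝ) (x : V) :
    𝔢 ((t - s) • A) x = 𝔢 (t • A) (𝔢 ((-s) • A) x) := by
  rw [sub_eq_add_neg, exp_add_smul_apply]

theorem exp_zero_smul_apply (A : V →L[ℝ] V) (x : V) : 𝔢 ((0 : ℝ) • A) x = x := by
  simp [NormedSpace.exp_zero]

theorem tame_exp_sub_apply (A : V →L[ℝ] V) {g : ℝ → V} (hg : Tame g) (t : ℝ) :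
    Tame fun s => 𝔢 ((t - s) • A) (g s) := by
  refine Tame.clm_apply (Continuous.tame ?_) hg
  exact (exp_smul_continuous A).comp (continuous_const.sub continuous_id)

theorem tame_exp_neg_apply (A : V →L[ℝ] V) {g : ℝ → V} (hg : Tame g) :
    Tame fun s => 𝔢 ((-s) • A) (g s) := by
  simpa using tame_exp_sub_apply A hg 0

variable [SecondCountableTopology V]

theorem integral_exp_sub_apply (A : V →L[ℝ] V) {g : ℝ → V} (hg : Tame g) (c t u : ℝ) :
    ∫ s in c..u, 𝔢 ((t - s) • A) (g s) = 𝔢 (t • A) (∫ s in c..u, 𝔢 ((-s) • A) (g s)) := by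
  simp_rw [exp_sub_smul_apply]
  exact (𝔢 (t • A)).intervalIntegral_comp_comm ((tame_exp_neg_apply A hg).intervalIntegrable _ _)

/-- The curve `s ↦ e^{(t-s)A} f(s)` has right derivative `e^{(t-s)A} g(s)`, the two `A`-terms
cancelling. No order between `c` and `t` is imposed: `u` is solved backwards from `0`, `v` forwards
from the remote past. -/
theorem eq_variation_of_constants (A : V →L[ℝ] V) {f g : ℝ → V} {c t : ℝ} (hf : Continuous f)
    (hg : Tame g) (hd : ∀ x ∈ Ioo (min c t) (max c t),
      HasDerivWithinAt f (A (f x) + g x) (Ici x) x) :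
    f t = 𝔢 ((t - c) • A) (f c) + ∫ s in c..t, 𝔢 ((t - s) • A) (g s) := by
  have h := (tame_exp_sub_apply A hg t).integral_eq_sub (a := c) (b := t)
    (f := fun s => 𝔢 ((t - s) • A) (f s)) ?_ ?_
  · rw [h]
    simp [NormedSpace.exp_zero]
  · exact ((exp_smul_continuous A).comp (continuous_const.sub continuous_id)).clm_apply hf
  · intro x hx
    have h1 : HasDerivAt (fun s : ℝ => 𝔢 ((t - s) • A)) (-(𝔢 ((t - x) • A) * A)) x := by
      have := (hasDerivAt_exp_smul_const (𝕂 := ℝ) A (t - x)).scomp x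
        ((hasDerivAt_const x t).sub (hasDerivAt_id x))
      simpa [Function.comp_def] using! this
    have h2 := (h1.hasDerivWithinAt (s := Ici x)).clm_apply (hd x hx)
    convert h2 using 1
    simp

theorem hasDerivWithinAt_variation_of_constants (A : V →L[ℝ] V) {g : ℝ → V} (hg : Tame g)
    (y : V) (c t : ℝ) :
    HasDerivWithinAt (fun u => 𝔢 (u • A) (y + ∫ s in c..u, 𝔢 ((-s) • A) (g s)))
      (A (𝔢 (t • A) (y + ∫ s in c..t, 𝔢 ((-s) • A) (g s))) + g t) (Ici t) t := by
  have h1 := (hasDerivAt_exp_smul_const' (𝕂 := ℝ) A t).hasDerivWithinAt (s := Ici t)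
  have h2 := h1.clm_apply
    (((tame_exp_neg_apply A hg).hasDerivWithinAt_integral c t).const_add y)
  convert h2 using 1
  rw [← exp_add_smul_apply, add_neg_cancel, exp_zero_smul_apply]
  rfl

/-! ### Dichotomy estimates -/

/-- The integrand is at most `C e^{bt} e^{(η-b)s}`, integrable at `-∞` because `b < η`; this is the
source of `1/(η-b)`. -/
theorem integrableOn_exp_sub_apply (B : V →L[ℝ] V) {b η C : ℝ} (hbη : b < η)
    (hB : ∀ t : ℝ, 0 ≤ t → ∀ y, ‖𝔢 (t • B) y‖ ≤ Real.exp (b * t) * ‖y‖) {g : ℝ → V} (hg : Tame g)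
    (hC : ∀ s ≤ 0, ‖g s‖ ≤ C * Real.exp (η * s)) {t : ℝ} (ht : t ≤ 0) :
    IntegrableOn (fun s => 𝔢 ((t - s) • B) (g s)) (Iic t) ∧
    ‖∫ s in Iic t, 𝔢 ((t - s) • B) (g s)‖ ≤ C / (η - b) * Real.exp (η * t) := by
  have hle : ∀ᵐ s ∂volume.restrict (Iic t), ‖𝔢 ((t - s) • B) (g s)‖
      ≤ C * Real.exp (b * t) * Real.exp ((η - b) * s) := by
    refine (ae_restrict_iff' measurableSet_Iic).2 (Eventually.of_forall fun s hs => ?_)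
    refine (hB (t - s) (sub_nonneg.2 hs) _).trans ?_
    refine (mul_le_mul_of_nonneg_left (hC s (le_trans hs ht)) (Real.exp_nonneg _)).trans_eq ?_
    rw [mul_left_comm, mul_assoc, ← Real.exp_add, ← Real.exp_add]
    ring_nf
  have hint : Integrable (fun s => C * Real.exp (b * t) * Real.exp ((η - b) * s))
      (volume.restrict (Iic t)) :=
    (integrableOn_exp_mul_Iic (sub_pos.2 hbη) t).const_mul _
  refine ⟨hint.mono' (tame_exp_sub_apply B hg t).stronglyMeasurable.aestronglyMeasurable hle, ?_⟩
  refine (norm_integral_le_of_norm_le hint hle).trans_eq ?_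
  rw [integral_const_mul, integral_exp_mul_Iic (sub_pos.2 hbη), mul_div_assoc', div_mul_eq_mul_div,
    mul_assoc, ← Real.exp_add]
  ring_nf

theorem norm_integral_exp_sub_apply_le (A : V →L[ℝ] V) {a η C : ℝ} (hηa : η < a)
    (hA : ∀ t : ℝ, t ≤ 0 → ∀ y, ‖𝔢 (t • A) y‖ ≤ Real.exp (a * t) * ‖y‖) {g : ℝ → V}
    (hC : ∀ s ≤ 0, ‖g s‖ ≤ C * Real.exp (η * s)) {t : ℝ} (ht : t ≤ 0) :
    ‖∫ s in (0 : ℝ)..t, 𝔢 ((t - s) • A) (g s)‖ ≤ C / (a - η) * Real.exp (η * t) := by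
  have hC0 : 0 ≤ C := by simpa using (norm_nonneg _).trans (hC 0 le_rfl)
  rw [intervalIntegral.integral_symm, norm_neg, intervalIntegral.integral_of_le ht]
  have hle : ∀ᵐ s ∂volume.restrict (Ioc t 0), ‖𝔢 ((t - s) • A) (g s)‖
      ≤ C * Real.exp (a * t) * Real.exp ((η - a) * s) := by
    refine (ae_restrict_iff' measurableSet_Ioc).2 (Eventually.of_forall fun s hs => ?_)
    refine (hA (t - s) (sub_nonpos.2 hs.1.le) _).trans ?_
    refine (mul_le_mul_of_nonneg_left (hC s hs.2) (Real.exp_nonneg _)).trans_eq ?_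
    rw [mul_left_comm, mul_assoc, ← Real.exp_add, ← Real.exp_add]
    ring_nf
  -- The majorant is integrable up to `+∞` because `η < a`. Enlarging `(t, 0]` to `(t, ∞)` yields
  -- the clean factor `1/(a-η)`.
  have hint : IntegrableOn (fun s => C * Real.exp (a * t) * Real.exp ((η - a) * s)) (Ioi t) :=
    (integrableOn_exp_mul_Ioi (sub_neg.2 hηa) t).const_mul _
  refine (norm_integral_le_of_norm_le (hint.mono_set Ioc_subset_Ioi_self) hle).trans ?_
  refine (setIntegral_mono_set hint (Eventually.of_forall fun s => by positivity)
    (LE.le.eventuallyLE Ioc_subset_Ioi_self)).trans_eq ?_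
  rw [integral_const_mul, integral_exp_mul_Ioi (sub_neg.2 hηa), ← neg_sub a η, neg_div_neg_eq,
    mul_div_assoc', div_mul_eq_mul_div, mul_assoc, ← Real.exp_add]
  ring_nf

end Semigroup

/-! ### Grönwall and a weighted contraction principle -/

theorem eq_zero_of_le_integral {f : ℝ → ℝ} (hf : Continuous f) (h0 : ∀ t, 0 ≤ f t) {L T : ℝ}
    (hle : ∀ t ∈ Icc 0 T, f t ≤ L * ∫ s in (0 : ℝ)..t, f s) : ∀ t ∈ Icc 0 T, f t = 0 := by
  have hd : ∀ t, HasDerivAt (fun u => ∫ s in (0 : ℝ)..u, f s) (f t) t := fun t =>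
    hf.integral_hasStrictDerivAt 0 t |>.hasDerivAt
  have hz := eq_zero_of_abs_deriv_le_mul_abs_self_of_eq_zero_right (K := L) (a := 0) (b := T)
    (f := fun u => ∫ s in (0 : ℝ)..u, f s) (f' := f)
    (fun t _ => (hd t).continuousAt.continuousWithinAt) (fun t _ => (hd t).hasDerivWithinAt)
    (by simp) (fun t ht => by
      have h1 : 0 ≤ ∫ s in (0 : ℝ)..t, f s :=
        intervalIntegral.integral_nonneg ht.1 fun s _ => h0 s
      rw [Real.norm_of_nonneg (h0 t), Real.norm_of_nonneg h1]
      exact hle t ⟨ht.1, ht.2.le⟩)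
  intro t ht
  refine le_antisymm ?_ (h0 t)
  have := hle t ht
  rwa [hz t ht, mul_zero] at this

/-- Multiplication by `w` identifies bounded continuous functions with the curves of size `O(w)`.
Conjugated by it, `T` becomes a `κ`-contraction in the sup norm, and Banach's theorem applies. -/
theorem exists_fixedPoint_of_weighted_contraction {V : Type*} [NormedAddCommGroup V]
    [NormedSpace ℝ V] [CompleteSpace V] {w : ℝ → ℝ} (hw : Continuous w) (hw0 : ∀ t, 0 < w t)
    {κ : ℝ} (hκ0 : 0 ≤ κ) (hκ : κ < 1) (T : (ℝ → V) → ℝ → V)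
    (hT : ∀ φ, Continuous φ → (∃ C, ∀ t, ‖φ t‖ ≤ C * w t) →
      Continuous (T φ) ∧ ∃ C, ∀ t, ‖T φ t‖ ≤ C * w t)
    (hlip : ∀ φ ψ C, Continuous φ → Continuous ψ → (∃ C, ∀ t, ‖φ t‖ ≤ C * w t) →
      (∃ C, ∀ t, ‖ψ t‖ ≤ C * w t) → (∀ t, ‖φ t - ψ t‖ ≤ C * w t) →
      ∀ t, ‖T φ t - T ψ t‖ ≤ κ * C * w t) :
    ∃ φ, Continuous φ ∧ (∃ C, ∀ t, ‖φ t‖ ≤ C * w t) ∧ T φ = φ := by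
  let u : BoundedContinuousFunction ℝ V → ℝ → V := fun ψ t => w t • ψ t
  have hu : ∀ ψ, Continuous (u ψ) := fun ψ => hw.smul ψ.continuous
  have hub : ∀ ψ, ∃ C, ∀ t, ‖u ψ t‖ ≤ C * w t := fun ψ => ⟨‖ψ‖, fun t => by
    simp only [u, norm_smul, Real.norm_of_nonneg (hw0 t).le]
    rw [mul_comm]
    exact mul_le_mul_of_nonneg_right (ψ.norm_coe_le_norm t) (hw0 t).le⟩
  have hcont : ∀ ψ, Continuous fun t => (w t)⁻¹ • T (u ψ) t := fun ψ =>
    (hw.inv₀ fun t => (hw0 t).ne').smul (hT _ (hu ψ) (hub ψ)).1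
  have hbdd : ∀ ψ, ∃ C, ∀ t, ‖(w t)⁻¹ • T (u ψ) t‖ ≤ C := by
    intro ψ
    obtain ⟨C, hC⟩ := (hT _ (hu ψ) (hub ψ)).2
    refine ⟨C, fun t => ?_⟩
    rw [norm_smul, norm_inv, Real.norm_of_nonneg (hw0 t).le, inv_mul_le_iff₀ (hw0 t), mul_comm]
    exact hC t
  let Φ : BoundedContinuousFunction ℝ V → BoundedContinuousFunction ℝ V := fun ψ =>
    BoundedContinuousFunction.ofNormedAddCommGroup (fun t => (w t)⁻¹ • T (u ψ) t) (hcont ψ)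
      (hbdd ψ).choose (hbdd ψ).choose_spec
  have hΦ : ContractingWith ⟨κ, hκ0⟩ Φ := by
    refine ⟨by exact_mod_cast hκ, LipschitzWith.of_dist_le_mul fun ψ χ => ?_⟩
    refine (BoundedContinuousFunction.dist_le (by positivity)).2 fun t => ?_
    have h := hlip (u ψ) (u χ) (dist ψ χ) (hu ψ) (hu χ) (hub ψ) (hub χ) (fun t => by
      simp only [u, ← smul_sub, norm_smul, Real.norm_of_nonneg (hw0 t).le]
      rw [mul_comm, ← dist_eq_norm]
      exact mul_le_mul_of_nonneg_right (BoundedContinuousFunction.dist_coe_le_dist t) (hw0 t).le) t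
    change dist ((w t)⁻¹ • T (u ψ) t) ((w t)⁻¹ • T (u χ) t) ≤ κ * dist ψ χ
    rw [dist_eq_norm, ← smul_sub, norm_smul, norm_inv, Real.norm_of_nonneg (hw0 t).le,
      inv_mul_le_iff₀ (hw0 t), mul_comm]
    exact h
  have hfix : Φ (ContractingWith.fixedPoint Φ hΦ) = ContractingWith.fixedPoint Φ hΦ :=
    hΦ.fixedPoint_isFixedPt
  set ψ := ContractingWith.fixedPoint Φ hΦ
  refine ⟨u ψ, hu ψ, hub ψ, funext fun t => ?_⟩
  have : (w t)⁻¹ • T (u ψ) t = ψ t := DFunLike.congr_fun hfix t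
  simp only [u] at this ⊢
  rw [← this, smul_inv_smul₀ (hw0 t).ne']

/-- The version of the weighted contraction principle for pairs, with the sum norm. -/
theorem exists_fixedPoint_of_weighted_contraction_prod {V W : Type*} [NormedAddCommGroup V]
    [NormedSpace ℝ V] [CompleteSpace V] [NormedAddCommGroup W] [NormedSpace ℝ W] [CompleteSpace W]
    {w : ℝ → ℝ} (hw : Continuous w) (hw0 : ∀ t, 0 < w t)
    {κ : ℝ} (hκ0 : 0 ≤ κ) (hκ : κ < 1) (T : (ℝ → V × W) → ℝ → V × W)
    (hT : ∀ φ, Continuous φ → (∃ C, ∀ t, ‖(φ t).1‖ + ‖(φ t).2‖ ≤ C * w t) →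
      Continuous (T φ) ∧ ∃ C, ∀ t, ‖(T φ t).1‖ + ‖(T φ t).2‖ ≤ C * w t)
    (hlip : ∀ φ ψ C, Continuous φ → Continuous ψ → (∃ C, ∀ t, ‖(φ t).1‖ + ‖(φ t).2‖ ≤ C * w t) →
      (∃ C, ∀ t, ‖(ψ t).1‖ + ‖(ψ t).2‖ ≤ C * w t) →
      (∀ t, ‖(φ t).1 - (ψ t).1‖ + ‖(φ t).2 - (ψ t).2‖ ≤ C * w t) →
      ∀ t, ‖(T φ t).1 - (T ψ t).1‖ + ‖(T φ t).2 - (T ψ t).2‖ ≤ κ * C * w t) :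
    ∃ φ, Continuous φ ∧ (∃ C, ∀ t, ‖(φ t).1‖ + ‖(φ t).2‖ ≤ C * w t) ∧ T φ = φ := by
  -- The Lipschitz condition is phrased in the sum norm. Working in `ℓ¹` rather than the max norm of
  -- the product keeps the contraction constant equal to that of the gap condition.
  let e := WithLp.prodContinuousLinearEquiv 1 ℝ V W
  have hn : ∀ x : WithLp 1 (V × W), ‖x‖ = ‖(e x).1‖ + ‖(e x).2‖ := fun x =>
    WithLp.prod_norm_eq_of_L1 x
  obtain ⟨φ, h1, h2, h3⟩ := exists_fixedPoint_of_weighted_contraction hw hw0 hκ0 hκ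
    (fun φ t => e.symm (T (fun s => e (φ s)) t))
    (by
      intro φ hφ hb
      obtain ⟨hc, hd⟩ := hT (fun s => e (φ s)) (e.continuous.comp hφ) (by simpa [hn] using hb)
      exact ⟨e.symm.continuous.comp hc, by simpa [hn] using hd⟩)
    (by
      intro φ ψ C hφ hψ hb hb' hle
      have := hlip (fun s => e (φ s)) (fun s => e (ψ s)) C (e.continuous.comp hφ)
        (e.continuous.comp hψ) (by simpa [hn] using hb) (by simpa [hn] using hb')
        (by simpa [hn] using hle)
      simpa [hn] using this)
  refine ⟨fun s => e (φ s), e.continuous.comp h1, by simpa [hn] using h2, funext fun t => ?_⟩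
  have := congrFun h3 t
  rw [ContinuousLinearEquiv.symm_apply_eq] at this
  exact this

/-! ### Semilinear split systems on the line -/

/-- The nonautonomous system `u' = A u + h(t, u, v)`, `v' = B v + k(t, u, v)`. -/
structure SplitSystem (V W : Type*) [NormedAddCommGroup V] [NormedSpace ℝ V]
    [NormedAddCommGroup W] [NormedSpace ℝ W] where
  A : V →L[ℝ] V
  B : W →L[ℝ] W
  h : ℝ → V × W → V
  k : ℝ → V × W → W

namespace SplitSystem

variable {V W : Type*} [NormedAddCommGroup V] [NormedSpace ℝ V] [CompleteSpace V]
  [SecondCountableTopology V] [NormedAddCommGroup W] [NormedSpace ℝ W] [CompleteSpace W]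
  [SecondCountableTopology W] (T : SplitSystem V W)

/-- The nonlinearities vanish at the origin, are `K`-Lipschitz for the sum norm and are
right-continuous in time along continuous curves. -/
structure IsLip (K : ℝ) : Prop where
  nonneg : 0 ≤ K
  h_rc : ∀ p : ℝ → V × W, Continuous p → ∀ t, ContinuousWithinAt (fun s => T.h s (p s)) (Ici t) t
  k_rc : ∀ p : ℝ → V × W, Continuous p → ∀ t, ContinuousWithinAt (fun s => T.k s (p s)) (Ici t) t
  h_zero : ∀ t, T.h t 0 = 0
  k_zero : ∀ t, T.k t 0 = 0
  h_lip : ∀ t p q, ‖T.h t p - T.h t q‖ ≤ K * (‖p.1 - q.1‖ + ‖p.2 - q.2‖)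
  k_lip : ∀ t p q, ‖T.k t p - T.k t q‖ ≤ K * (‖p.1 - q.1‖ + ‖p.2 - q.2‖)

/-- The continuous curve `p` satisfies the integrated system at the times in `J`. -/
structure IsOrbitOn (J : Set ℝ) (p : ℝ → V × W) : Prop where
  cont : Continuous p
  eq_fst : ∀ t ∈ J, (p t).1 = (p 0).1 + ∫ s in (0 : ℝ)..t, (T.A (p s).1 + T.h s (p s))
  eq_snd : ∀ t ∈ J, (p t).2 = (p 0).2 + ∫ s in (0 : ℝ)..t, (T.B (p s).2 + T.k s (p s))

variable {T} {K : ℝ} {p q φ ψ : ℝ → V × W} {J : Set ℝ}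

theorem continuous_sumNorm (hp : Continuous p) : Continuous fun s => ‖(p s).1‖ + ‖(p s).2‖ :=
  hp.fst.norm.add hp.snd.norm

theorem IsLip.norm_h_le (hT : T.IsLip K) (t : ℝ) (x : V × W) :
    ‖T.h t x‖ ≤ K * (‖x.1‖ + ‖x.2‖) := by
  simpa [hT.h_zero] using hT.h_lip t x 0

theorem IsLip.norm_k_le (hT : T.IsLip K) (t : ℝ) (x : V × W) :
    ‖T.k t x‖ ≤ K * (‖x.1‖ + ‖x.2‖) := by
  simpa [hT.k_zero] using hT.k_lip t x 0

theorem IsLip.tame_h (hT : T.IsLip K) (hp : Continuous p) : Tame fun s => T.h s (p s) :=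
  Tame.of_norm_le (hT.h_rc p hp) ((continuous_const.mul (continuous_sumNorm hp)).tame)
    fun t => hT.norm_h_le t (p t)

theorem IsLip.tame_k (hT : T.IsLip K) (hp : Continuous p) : Tame fun s => T.k s (p s) :=
  Tame.of_norm_le (hT.k_rc p hp) ((continuous_const.mul (continuous_sumNorm hp)).tame)
    fun t => hT.norm_k_le t (p t)

theorem IsLip.tame_fst (hT : T.IsLip K) (hp : Continuous p) :
    Tame fun s => T.A (p s).1 + T.h s (p s) :=
  (T.A.continuous.comp hp.fst).tame.add (hT.tame_h hp)

theorem IsLip.tame_snd (hT : T.IsLip K) (hp : Continuous p) :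
    Tame fun s => T.B (p s).2 + T.k s (p s) :=
  (T.B.continuous.comp hp.snd).tame.add (hT.tame_k hp)

theorem IsLip.norm_integral_sub_le (hT : T.IsLip K) (hφ : Continuous φ) (hψ : Continuous ψ)
    (t : ℝ) :
    ‖(∫ s in (0 : ℝ)..t, (T.A (φ s).1 + T.h s (φ s))) -
        ∫ s in (0 : ℝ)..t, (T.A (ψ s).1 + T.h s (ψ s))‖ +
      ‖(∫ s in (0 : ℝ)..t, (T.B (φ s).2 + T.k s (φ s))) -
        ∫ s in (0 : ℝ)..t, (T.B (ψ s).2 + T.k s (ψ s))‖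
      ≤ (‖T.A‖ + ‖T.B‖ + 2 * K) *
        |∫ s in (0 : ℝ)..t, (‖(φ s).1 - (ψ s).1‖ + ‖(φ s).2 - (ψ s).2‖)| := by
  have hδ : Continuous fun s => ‖(φ s).1 - (ψ s).1‖ + ‖(φ s).2 - (ψ s).2‖ :=
    continuous_sumNorm (hφ.sub hψ)
  have h1 : ‖(∫ s in (0 : ℝ)..t, (T.A (φ s).1 + T.h s (φ s))) -
        ∫ s in (0 : ℝ)..t, (T.A (ψ s).1 + T.h s (ψ s))‖ ≤ (‖T.A‖ + K) *
        |∫ s in (0 : ℝ)..t, (‖(φ s).1 - (ψ s).1‖ + ‖(φ s).2 - (ψ s).2‖)| := by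
    rw [← intervalIntegral.integral_sub ((hT.tame_fst hφ).intervalIntegrable _ _)
      ((hT.tame_fst hψ).intervalIntegrable _ _)]
    have hi : IntervalIntegrable (fun s => (‖T.A‖ + K) *
        (‖(φ s).1 - (ψ s).1‖ + ‖(φ s).2 - (ψ s).2‖)) volume 0 t :=
      (continuous_const.mul hδ).intervalIntegrable _ _
    refine (intervalIntegral.norm_integral_le_abs_of_norm_le (Eventually.of_forall fun s => ?_)
      hi).trans_eq ?_
    · rw [add_sub_add_comm, ← map_sub, add_mul]
      refine (norm_add_le _ _).trans (add_le_add ((T.A.le_opNorm _).trans ?_) (hT.h_lip _ _ _))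
      exact mul_le_mul_of_nonneg_left (le_add_of_nonneg_right (norm_nonneg _)) (norm_nonneg _)
    · rw [intervalIntegral.integral_const_mul, abs_mul,
        abs_of_nonneg (add_nonneg (norm_nonneg _) hT.nonneg)]
  have h2 : ‖(∫ s in (0 : ℝ)..t, (T.B (φ s).2 + T.k s (φ s))) -
        ∫ s in (0 : ℝ)..t, (T.B (ψ s).2 + T.k s (ψ s))‖ ≤ (‖T.B‖ + K) *
        |∫ s in (0 : ℝ)..t, (‖(φ s).1 - (ψ s).1‖ + ‖(φ s).2 - (ψ s).2‖)| := by
    rw [← intervalIntegral.integral_sub ((hT.tame_snd hφ).intervalIntegrable _ _)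
      ((hT.tame_snd hψ).intervalIntegrable _ _)]
    have hi : IntervalIntegrable (fun s => (‖T.B‖ + K) *
        (‖(φ s).1 - (ψ s).1‖ + ‖(φ s).2 - (ψ s).2‖)) volume 0 t :=
      (continuous_const.mul hδ).intervalIntegrable _ _
    refine (intervalIntegral.norm_integral_le_abs_of_norm_le (Eventually.of_forall fun s => ?_)
      hi).trans_eq ?_
    · rw [add_sub_add_comm, ← map_sub, add_mul]
      refine (norm_add_le _ _).trans (add_le_add ((T.B.le_opNorm _).trans ?_) (hT.k_lip _ _ _))
      exact mul_le_mul_of_nonneg_left (le_add_of_nonneg_left (norm_nonneg _)) (norm_nonneg _)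
    · rw [intervalIntegral.integral_const_mul, abs_mul,
        abs_of_nonneg (add_nonneg (norm_nonneg _) hT.nonneg)]
  linarith

/-- Grönwall for the sum norm of the difference, with time reversed for negative `t`. No growth
restriction is imposed on the orbits. -/
theorem IsOrbitOn.eqOn (hT : T.IsLip K) (hJ : ∀ t ∈ J, uIcc 0 t ⊆ J) (hp : T.IsOrbitOn J p)
    (hq : T.IsOrbitOn J q) (h0 : p 0 = q 0) : EqOn p q J := by
  set δ : ℝ → ℝ := fun s => ‖(p s).1 - (q s).1‖ + ‖(p s).2 - (q s).2‖ with hδ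
  have hδc : Continuous δ := continuous_sumNorm (hp.cont.sub hq.cont)
  have hδ0 : ∀ t, 0 ≤ δ t := fun t => by positivity
  have key : ∀ t ∈ J, δ t ≤ (‖T.A‖ + ‖T.B‖ + 2 * K) * |∫ s in (0 : ℝ)..t, δ s| := by
    intro t ht
    have := hT.norm_integral_sub_le hp.cont hq.cont t
    simp only [hδ]
    rw [hp.eq_fst t ht, hp.eq_snd t ht, hq.eq_fst t ht, hq.eq_snd t ht, h0,
      add_sub_add_left_eq_sub, add_sub_add_left_eq_sub]
    exact this
  intro t ht
  have hzero : δ t = 0 := by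
    rcases le_total 0 t with h | h
    · refine eq_zero_of_le_integral hδc hδ0 (L := ‖T.A‖ + ‖T.B‖ + 2 * K) (T := t)
        (fun s hs => ?_) t ⟨h, le_rfl⟩
      have := key s (hJ t ht (by rwa [uIcc_of_le h]))
      rwa [abs_of_nonneg (intervalIntegral.integral_nonneg hs.1 fun r _ => hδ0 r)] at this
    · have := eq_zero_of_le_integral (f := fun s => δ (-s)) (hδc.comp continuous_neg)
        (fun s => hδ0 _) (L := ‖T.A‖ + ‖T.B‖ + 2 * K) (T := -t)
        (fun s hs => ?_) (-t) ⟨by linarith, le_rfl⟩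
      · simpa using this
      · have h2 := key (-s) (hJ t ht (by rw [uIcc_of_ge h]; constructor <;> linarith [hs.1, hs.2]))
        rw [intervalIntegral.integral_comp_neg (fun s => δ s), neg_zero]
        rwa [intervalIntegral.integral_symm, abs_neg, abs_of_nonneg
          (intervalIntegral.integral_nonneg (by linarith [hs.1]) fun r _ => hδ0 r)] at h2
  have h1 : ‖(p t).1 - (q t).1‖ = 0 := le_antisymm
    (hzero ▸ le_add_of_nonneg_right (norm_nonneg _)) (norm_nonneg _)
  have h2 : ‖(p t).2 - (q t).2‖ = 0 := le_antisymm
    (hzero ▸ le_add_of_nonneg_left (norm_nonneg _)) (norm_nonneg _)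
  exact Prod.ext (sub_eq_zero.1 (norm_eq_zero.1 h1)) (sub_eq_zero.1 (norm_eq_zero.1 h2))

theorem abs_integral_exp_abs_le {c : ℝ} (hc : 0 < c) (t : ℝ) :
    |∫ s in (0 : ℝ)..t, Real.exp (c * |s|)| ≤ Real.exp (c * |t|) / c := by
  have key : ∀ t : ℝ, 0 ≤ t → |∫ s in (0 : ℝ)..t, Real.exp (c * |s|)| ≤ Real.exp (c * |t|) / c := by
    intro t ht
    have h1 : ∫ s in (0 : ℝ)..t, Real.exp (c * |s|) = ∫ s in (0 : ℝ)..t, Real.exp (c * s) :=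
      intervalIntegral.integral_congr fun s hs => by
        rw [uIcc_of_le ht] at hs
        simp only [abs_of_nonneg hs.1]
    have h2 : ∫ s in (0 : ℝ)..t, Real.exp (c * s) = c⁻¹ * (Real.exp (c * t) - 1) := by
      rw [intervalIntegral.integral_comp_mul_left (fun s => Real.exp s) hc.ne']
      simp
    have h3 : 1 ≤ Real.exp (c * t) := Real.one_le_exp (by positivity)
    rw [h1, h2, abs_of_nonneg ht, abs_of_nonneg (by have := inv_pos.2 hc; nlinarith), div_eq_inv_mul]
    exact mul_le_mul_of_nonneg_left (by linarith) (inv_pos.2 hc).le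
  rcases le_total 0 t with h | h
  · exact key t h
  · have := key (-t) (by linarith)
    rw [abs_neg t] at this
    refine le_trans (le_of_eq ?_) this
    have h2 := intervalIntegral.integral_comp_neg (a := 0) (b := t)
      (fun s => Real.exp (c * |s|))
    simp only [abs_neg, neg_zero] at h2
    rw [h2, intervalIntegral.integral_symm, abs_neg]

/-- Picard iteration on the whole line at once: with weight `e^{c|t|}`, integration from `0` gains a
factor `1/c`, which beats the global Lipschitz constant `L` of the field. -/
theorem IsLip.exists_orbit (hT : T.IsLip K) (p₀ : V × W) :
    ∃ p, T.IsOrbitOn univ p ∧ p 0 = p₀ := by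
  set L := ‖T.A‖ + ‖T.B‖ + 2 * K with hL
  have hL0 : 0 ≤ L := by have := hT.nonneg; positivity
  -- Chosen so that `L / c ≤ 1/2`; the `+ 1` keeps `c` positive when `L = 0`.
  set c := 2 * (L + 1) with hc
  have hc0 : 0 < c := by positivity
  set w : ℝ → ℝ := fun t => Real.exp (c * |t|) with hw
  have hwc : Continuous w := by fun_prop
  have hw1 : ∀ t, 1 ≤ w t := fun t => Real.one_le_exp (by positivity)
  let Ψ : (ℝ → V × W) → ℝ → V × W := fun φ t =>
    (p₀.1 + ∫ s in (0 : ℝ)..t, (T.A (φ s).1 + T.h s (φ s)),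
      p₀.2 + ∫ s in (0 : ℝ)..t, (T.B (φ s).2 + T.k s (φ s)))
  have hΨc : ∀ φ, Continuous φ → Continuous (Ψ φ) := fun φ hφ =>
    (continuous_const.add ((hT.tame_fst hφ).continuous_integral 0)).prodMk
      (continuous_const.add ((hT.tame_snd hφ).continuous_integral 0))
  have hlip : ∀ φ ψ C, Continuous φ → Continuous ψ →
      (∀ t, ‖(φ t).1 - (ψ t).1‖ + ‖(φ t).2 - (ψ t).2‖ ≤ C * w t) →
      ∀ t, ‖(Ψ φ t).1 - (Ψ ψ t).1‖ + ‖(Ψ φ t).2 - (Ψ ψ t).2‖ ≤ 1 / 2 * C * w t := by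
    intro φ ψ C hφ hψ hle t
    have hC : 0 ≤ C := nonneg_of_mul_nonneg_left
      (le_trans (by positivity) (hle 0)) (zero_lt_one.trans_le (hw1 0))
    simp only [Ψ, add_sub_add_left_eq_sub]
    refine (hT.norm_integral_sub_le hφ hψ t).trans ?_
    have h1 : |∫ s in (0 : ℝ)..t, (‖(φ s).1 - (ψ s).1‖ + ‖(φ s).2 - (ψ s).2‖)|
        ≤ C * (w t / c) := by
      have hi : IntervalIntegrable (fun s => C * w s) volume 0 t :=
        (continuous_const.mul hwc).intervalIntegrable _ _
      rw [← Real.norm_eq_abs]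
      refine (intervalIntegral.norm_integral_le_abs_of_norm_le (Eventually.of_forall fun s => ?_)
        hi).trans ?_
      · rw [Real.norm_of_nonneg (by positivity)]
        exact hle s
      · rw [intervalIntegral.integral_const_mul, abs_mul, abs_of_nonneg hC]
        exact mul_le_mul_of_nonneg_left (abs_integral_exp_abs_le hc0 t) hC
    refine (mul_le_mul_of_nonneg_left h1 hL0).trans ?_
    have h2 : L / c ≤ 1 / 2 := by
      rw [div_le_iff₀ hc0, hc]; linarith
    calc L * (C * (w t / c)) = L / c * (C * w t) := by ring
      _ ≤ 1 / 2 * (C * w t) :=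
        mul_le_mul_of_nonneg_right h2 (mul_nonneg hC (zero_le_one.trans (hw1 t)))
      _ = _ := by ring
  obtain ⟨φ, hφ, -, hfix⟩ := exists_fixedPoint_of_weighted_contraction_prod hwc
    (fun t => zero_lt_one.trans_le (hw1 t)) (κ := 1 / 2) (by norm_num) (by norm_num) Ψ
    (by
      rintro φ hφ ⟨C, hC⟩
      refine ⟨hΨc φ hφ, ‖p₀.1‖ + ‖p₀.2‖ + 1 / 2 * C, fun t => ?_⟩
      have h0 : ∀ t, Ψ (fun _ => 0) t = p₀ := fun t => by
        simp [Ψ, hT.h_zero, hT.k_zero]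
      have := hlip φ (fun _ => 0) C hφ continuous_const (by simpa using hC) t
      rw [h0] at this
      have h1 := norm_le_norm_add_norm_sub' (Ψ φ t).1 p₀.1
      have h2 := norm_le_norm_add_norm_sub' (Ψ φ t).2 p₀.2
      have h3 : ‖p₀.1‖ + ‖p₀.2‖ ≤ (‖p₀.1‖ + ‖p₀.2‖) * w t :=
        le_mul_of_one_le_right (by positivity) (hw1 t)
      linarith)
    (fun φ ψ C hφ hψ _ _ hle => hlip φ ψ C hφ hψ hle)
  have h0 : φ 0 = p₀ := by
    rw [← hfix]; simp [Ψ]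
  refine ⟨φ, ⟨hφ, fun t _ => ?_, fun t _ => ?_⟩, h0⟩
  · rw [h0]; exact congrArg Prod.fst (congrFun hfix t).symm
  · rw [h0]; exact congrArg Prod.snd (congrFun hfix t).symm

/-! ### The system of differences from a reference orbit -/

/-- The system satisfied by the differences of orbits from the orbit `p`. -/
def diff (T : SplitSystem V W) (p : ℝ → V × W) : SplitSystem V W where
  A := T.A
  B := T.B
  h t x := T.h t (x + p t) - T.h t (p t)
  k t x := T.k t (x + p t) - T.k t (p t)

theorem IsLip.diff (hT : T.IsLip K) (hp : Continuous p) : (T.diff p).IsLip K where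
  nonneg := hT.nonneg
  h_rc q hq t := (hT.h_rc _ (hq.add hp) t).sub (hT.h_rc _ hp t)
  k_rc q hq t := (hT.k_rc _ (hq.add hp) t).sub (hT.k_rc _ hp t)
  h_zero t := by simp [SplitSystem.diff]
  k_zero t := by simp [SplitSystem.diff]
  h_lip t x y := by simpa [SplitSystem.diff] using hT.h_lip t (x + p t) (y + p t)
  k_lip t x y := by simpa [SplitSystem.diff] using hT.k_lip t (x + p t) (y + p t)

theorem IsOrbitOn.sub (hT : T.IsLip K) (hp : T.IsOrbitOn J p) (hq : T.IsOrbitOn J q) :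
    (T.diff p).IsOrbitOn J (fun t => q t - p t) where
  cont := hq.cont.sub hp.cont
  eq_fst t ht := by
    have : (fun s => (T.diff p).A (q s - p s).1 + (T.diff p).h s (q s - p s)) =
        fun s => (T.A (q s).1 + T.h s (q s)) - (T.A (p s).1 + T.h s (p s)) := by
      funext s
      simp [SplitSystem.diff]
      abel
    rw [this, intervalIntegral.integral_sub ((hT.tame_fst hq.cont).intervalIntegrable _ _)
      ((hT.tame_fst hp.cont).intervalIntegrable _ _), Prod.fst_sub, Prod.fst_sub, hq.eq_fst t ht,
      hp.eq_fst t ht]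
    abel
  eq_snd t ht := by
    have : (fun s => (T.diff p).B (q s - p s).2 + (T.diff p).k s (q s - p s)) =
        fun s => (T.B (q s).2 + T.k s (q s)) - (T.B (p s).2 + T.k s (p s)) := by
      funext s
      simp [SplitSystem.diff]
      abel
    rw [this, intervalIntegral.integral_sub ((hT.tame_snd hq.cont).intervalIntegrable _ _)
      ((hT.tame_snd hp.cont).intervalIntegrable _ _), Prod.snd_sub, Prod.snd_sub, hq.eq_snd t ht,
      hp.eq_snd t ht]
    abel

theorem IsOrbitOn.add_of_diff (hT : T.IsLip K) (hp : T.IsOrbitOn J p)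
    (hφ : (T.diff p).IsOrbitOn J φ) : T.IsOrbitOn J (fun t => φ t + p t) where
  cont := hφ.cont.add hp.cont
  eq_fst t ht := by
    have : (fun s => T.A (φ s + p s).1 + T.h s (φ s + p s)) =
        fun s => ((T.diff p).A (φ s).1 + (T.diff p).h s (φ s)) + (T.A (p s).1 + T.h s (p s)) := by
      funext s
      simp [SplitSystem.diff]
      abel
    rw [this, intervalIntegral.integral_add
      (((hT.diff hp.cont).tame_fst hφ.cont).intervalIntegrable _ _)
      ((hT.tame_fst hp.cont).intervalIntegrable _ _), Prod.fst_add, Prod.fst_add, hφ.eq_fst t ht,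
      hp.eq_fst t ht]
    abel
  eq_snd t ht := by
    have : (fun s => T.B (φ s + p s).2 + T.k s (φ s + p s)) =
        fun s => ((T.diff p).B (φ s).2 + (T.diff p).k s (φ s)) + (T.B (p s).2 + T.k s (p s)) := by
      funext s
      simp [SplitSystem.diff]
      abel
    rw [this, intervalIntegral.integral_add
      (((hT.diff hp.cont).tame_snd hφ.cont).intervalIntegrable _ _)
      ((hT.tame_snd hp.cont).intervalIntegrable _ _), Prod.snd_add, Prod.snd_add, hφ.eq_snd t ht,
      hp.eq_snd t ht]
    abel

/-! ### The Lyapunov–Perron system -/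

local notation "𝔢" => NormedSpace.exp

variable (T) in
/-- Dichotomy estimates for the linear parts. -/
structure HasDichotomy (a b : ℝ) : Prop where
  bound_A : ∀ t : ℝ, t ≤ 0 → ∀ x, ‖𝔢 (t • T.A) x‖ ≤ Real.exp (a * t) * ‖x‖
  bound_B : ∀ t : ℝ, 0 ≤ t → ∀ y, ‖𝔢 (t • T.B) y‖ ≤ Real.exp (b * t) * ‖y‖

variable (T) in
/-- The right-hand side of the Lyapunov–Perron system. -/
def lpMap (u₀ : V) (φ : ℝ → V × W) (t : ℝ) : V × W :=
  (𝔢 (t • T.A) u₀ + ∫ s in (0 : ℝ)..t, 𝔢 ((t - s) • T.A) (T.h s (φ s)),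
    ∫ s in Iic t, 𝔢 ((t - s) • T.B) (T.k s (φ s)))

/-- Exponential decay of rate `η` towards `-∞`. -/
def Decays (η : ℝ) (φ : ℝ → V × W) : Prop :=
  ∃ C : ℝ, ∀ t ≤ 0, ‖(φ t).1‖ + ‖(φ t).2‖ ≤ C * Real.exp (η * t)

variable (T) in
/-- Continuous, decaying solutions of the Lyapunov–Perron system on `(-∞, 0]`. -/
structure IsLP (η : ℝ) (u₀ : V) (φ : ℝ → V × W) : Prop where
  cont : Continuous φ
  decays : Decays η φ
  eq : ∀ t ≤ 0, φ t = T.lpMap u₀ φ t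

variable {a b η : ℝ}

theorem IsLip.integrableOn_lp (hT : T.IsLip K) (hd : T.HasDichotomy a b) (hbη : b < η)
    (hφ : Continuous φ) (hdec : Decays η φ) {t : ℝ} (ht : t ≤ 0) :
    IntegrableOn (fun s => 𝔢 ((t - s) • T.B) (T.k s (φ s))) (Iic t) := by
  obtain ⟨C, hC⟩ := hdec
  refine (integrableOn_exp_sub_apply T.B hbη hd.bound_B (hT.tame_k hφ) (C := K * C)
    (fun s hs => ?_) ht).1
  refine (hT.norm_k_le _ _).trans ?_
  rw [mul_assoc]
  exact mul_le_mul_of_nonneg_left (hC s hs) hT.nonneg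

theorem IsLip.norm_lpMap_fst_sub_le (hT : T.IsLip K) (hd : T.HasDichotomy a b)
    (hηa : η < a) (hφ : Continuous φ) (hψ : Continuous ψ) {u₀ u₁ : V} {C : ℝ}
    (hC : ∀ t ≤ 0, ‖(φ t).1 - (ψ t).1‖ + ‖(φ t).2 - (ψ t).2‖ ≤ C * Real.exp (η * t))
    {t : ℝ} (ht : t ≤ 0) :
    ‖(T.lpMap u₀ φ t).1 - (T.lpMap u₁ ψ t).1‖
      ≤ (‖u₀ - u₁‖ + K * C / (a - η)) * Real.exp (η * t) := by
  have h1 : (T.lpMap u₀ φ t).1 - (T.lpMap u₁ ψ t).1 = 𝔢 (t • T.A) (u₀ - u₁) +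
      ∫ s in (0 : ℝ)..t, 𝔢 ((t - s) • T.A) (T.h s (φ s) - T.h s (ψ s)) := by
    simp only [lpMap, map_sub]
    rw [intervalIntegral.integral_sub
      ((tame_exp_sub_apply T.A (hT.tame_h hφ) t).intervalIntegrable _ _)
      ((tame_exp_sub_apply T.A (hT.tame_h hψ) t).intervalIntegrable _ _)]
    abel
  rw [h1, add_mul]
  refine (norm_add_le _ _).trans (add_le_add ((hd.bound_A t ht _).trans ?_)
    (norm_integral_exp_sub_apply_le T.A hηa hd.bound_A (fun s hs => ?_) ht))
  · rw [mul_comm]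
    refine mul_le_mul_of_nonneg_left (Real.exp_le_exp.2 ?_) (norm_nonneg _)
    exact mul_le_mul_of_nonpos_right hηa.le ht
  · refine (hT.h_lip _ _ _).trans ?_
    rw [mul_assoc]
    exact mul_le_mul_of_nonneg_left (hC s hs) hT.nonneg

/-- The second component does not contain the initial datum, so the bound has no `‖u₀ - u₁‖` term.
The Lipschitz constant of the graph map relies on this. -/
theorem IsLip.norm_lpMap_snd_sub_le (hT : T.IsLip K) (hd : T.HasDichotomy a b)
    (hbη : b < η) (hφ : Continuous φ) (hψ : Continuous ψ)
    (hφd : Decays η φ) (hψd : Decays η ψ) {u₀ u₁ : V} {C : ℝ}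
    (hC : ∀ t ≤ 0, ‖(φ t).1 - (ψ t).1‖ + ‖(φ t).2 - (ψ t).2‖ ≤ C * Real.exp (η * t))
    {t : ℝ} (ht : t ≤ 0) :
    ‖(T.lpMap u₀ φ t).2 - (T.lpMap u₁ ψ t).2‖ ≤ K * C / (η - b) * Real.exp (η * t) := by
  have h1 : (T.lpMap u₀ φ t).2 - (T.lpMap u₁ ψ t).2 =
      ∫ s in Iic t, 𝔢 ((t - s) • T.B) (T.k s (φ s) - T.k s (ψ s)) := by
    simp only [lpMap, map_sub]
    rw [integral_sub (hT.integrableOn_lp hd hbη hφ hφd ht) (hT.integrableOn_lp hd hbη hψ hψd ht)]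
  rw [h1]
  refine (integrableOn_exp_sub_apply T.B hbη hd.bound_B ((hT.tame_k hφ).sub (hT.tame_k hψ))
    (fun s hs => ?_) ht).2
  refine (hT.k_lip _ _ _).trans ?_
  rw [mul_assoc]
  exact mul_le_mul_of_nonneg_left (hC s hs) hT.nonneg

theorem IsLip.norm_lpMap_sub_le (hT : T.IsLip K) (hd : T.HasDichotomy a b)
    (hbη : b < η) (hηa : η < a) (hφ : Continuous φ) (hψ : Continuous ψ)
    (hφd : Decays η φ) (hψd : Decays η ψ) {u₀ u₁ : V} {C : ℝ}
    (hC : ∀ t ≤ 0, ‖(φ t).1 - (ψ t).1‖ + ‖(φ t).2 - (ψ t).2‖ ≤ C * Real.exp (η * t))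
    {t : ℝ} (ht : t ≤ 0) :
    ‖(T.lpMap u₀ φ t).1 - (T.lpMap u₁ ψ t).1‖ + ‖(T.lpMap u₀ φ t).2 - (T.lpMap u₁ ψ t).2‖
      ≤ (‖u₀ - u₁‖ + K * (1 / (η - b) + 1 / (a - η)) * C) * Real.exp (η * t) := by
  have h1 := hT.norm_lpMap_fst_sub_le hd hηa hφ hψ (u₀ := u₀) (u₁ := u₁) hC ht
  have h2 := hT.norm_lpMap_snd_sub_le hd hbη hφ hψ hφd hψd (u₀ := u₀) (u₁ := u₁) hC ht
  refine (add_le_add h1 h2).trans_eq ?_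
  ring

/-- Pulling `e^{tA}` and `e^{tB}` out leaves integrands independent of `t`, so that continuity and
right differentiability in `t` become visible. -/
theorem IsLip.lpMap_eq (hT : T.IsLip K) (hd : T.HasDichotomy a b) (hbη : b < η)
    (hφ : Continuous φ) (hφd : Decays η φ) (u₀ : V) {t : ℝ} (ht : t ≤ 0) :
    T.lpMap u₀ φ t = (𝔢 (t • T.A) (u₀ + ∫ s in (0 : ℝ)..t, 𝔢 ((-s) • T.A) (T.h s (φ s))),
      𝔢 (t • T.B) ((∫ s in Iic (0 : ℝ), 𝔢 ((-s) • T.B) (T.k s (φ s))) +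
        ∫ s in (0 : ℝ)..t, 𝔢 ((-s) • T.B) (T.k s (φ s)))) := by
  have h0 : IntegrableOn (fun s => 𝔢 ((-s) • T.B) (T.k s (φ s))) (Iic 0) := by
    simpa using hT.integrableOn_lp hd hbη hφ hφd le_rfl
  refine Prod.ext ?_ ?_
  · simp only [lpMap]
    rw [integral_exp_sub_apply T.A (hT.tame_h hφ), map_add]
  · simp only [lpMap]
    have h1 : (∫ s in Iic (0 : ℝ), 𝔢 ((-s) • T.B) (T.k s (φ s))) +
        (∫ s in (0 : ℝ)..t, 𝔢 ((-s) • T.B) (T.k s (φ s))) =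
        ∫ s in Iic t, 𝔢 ((-s) • T.B) (T.k s (φ s)) := by
      rw [← intervalIntegral.integral_Iic_sub_Iic h0 (h0.mono_set (Iic_subset_Iic.2 ht))]
      abel
    rw [h1]
    simp_rw [exp_sub_smul_apply T.B t]
    exact (𝔢 (t • T.B)).integral_comp_comm (h0.mono_set (Iic_subset_Iic.2 ht))

theorem IsLip.continuous_lpMap (hT : T.IsLip K) (hd : T.HasDichotomy a b) (hbη : b < η)
    (hφ : Continuous φ) (hφd : Decays η φ) (u₀ : V) :
    Continuous fun t => T.lpMap u₀ φ (min t 0) := by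
  have hm : Continuous fun t : ℝ => min t 0 := by fun_prop
  have : (fun t => T.lpMap u₀ φ (min t 0)) = fun t => _ :=
    funext fun t => hT.lpMap_eq hd hbη hφ hφd u₀ (min_le_right t 0)
  rw [this]
  refine Continuous.prodMk ?_ ?_
  · refine ((exp_smul_continuous T.A).comp hm).clm_apply (continuous_const.add ?_)
    exact ((tame_exp_neg_apply T.A (hT.tame_h hφ)).continuous_integral 0).comp hm
  · refine ((exp_smul_continuous T.B).comp hm).clm_apply (continuous_const.add ?_)
    exact ((tame_exp_neg_apply T.B (hT.tame_k hφ)).continuous_integral 0).comp hm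

theorem lpMap_congr {u₀ : V} (h : EqOn φ ψ (Iic 0)) {t : ℝ} (ht : t ≤ 0) :
    T.lpMap u₀ φ t = T.lpMap u₀ ψ t := by
  refine Prod.ext ?_ ?_
  · simp only [lpMap]
    congr 1
    refine intervalIntegral.integral_congr fun s hs => ?_
    rw [uIcc_of_ge ht] at hs
    simp only [h hs.2]
  · simp only [lpMap]
    refine setIntegral_congr_fun measurableSet_Iic fun s hs => ?_
    simp only [h (le_trans hs ht)]

theorem IsLip.exists_isLP (hT : T.IsLip K) (hd : T.HasDichotomy a b)
    (hbη : b < η) (hηa : η < a) (hgap : K * (1 / (η - b) + 1 / (a - η)) < 1) (u₀ : V) :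
    ∃ φ, T.IsLP η u₀ φ := by
  have hκ0 : 0 ≤ K * (1 / (η - b) + 1 / (a - η)) := by
    have := hT.nonneg; have := sub_pos.2 hbη; have := sub_pos.2 hηa; positivity
  have hdec : ∀ {φ : ℝ → V × W},
      (∃ C, ∀ t, ‖(φ t).1‖ + ‖(φ t).2‖ ≤ C * Real.exp (η * min t 0)) → Decays η φ := by
    rintro φ ⟨C, hC⟩
    exact ⟨C, fun t ht => by simpa [min_eq_left ht] using hC t⟩
  obtain ⟨φ, hφ, hb, hfix⟩ := exists_fixedPoint_of_weighted_contraction_prod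
    -- Freezing weight and image at time `0` turns the half-line problem into one on `ℝ`; values at
    -- positive times do not enter the equations.
    (w := fun t => Real.exp (η * min t 0)) (by fun_prop) (fun t => Real.exp_pos _) hκ0 hgap
    (fun φ t => T.lpMap u₀ φ (min t 0))
    (by
      intro φ hφ hb
      refine ⟨hT.continuous_lpMap hd hbη hφ (hdec hb) u₀, ?_⟩
      obtain ⟨C, hC⟩ := hdec hb
      have h0 : ∀ t, T.lpMap (0 : V) (fun _ => (0 : V × W)) t = 0 := fun t => by
        simp [lpMap, hT.h_zero, hT.k_zero]
      refine ⟨‖u₀ - 0‖ + K * (1 / (η - b) + 1 / (a - η)) * C, fun t => ?_⟩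
      have := hT.norm_lpMap_sub_le hd hbη hηa hφ continuous_const ⟨C, hC⟩ ⟨0, by simp⟩
        (ψ := fun _ => (0 : V × W)) (u₀ := u₀) (u₁ := 0) (by simpa using hC) (min_le_right t 0)
      rw [h0] at this
      simpa using this)
    (by
      intro φ ψ C hφ hψ hb hb' hle t
      have := hT.norm_lpMap_sub_le hd hbη hηa hφ hψ (hdec hb) (hdec hb') (u₀ := u₀) (u₁ := u₀)
        (C := C) (fun t ht => by simpa [min_eq_left ht] using hle t) (min_le_right t 0)
      simpa using this)
  refine ⟨φ, hφ, hdec hb, fun t ht => ?_⟩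
  have := congrFun hfix t
  rw [min_eq_left ht] at this
  exact this.symm

theorem Decays.sub (hφ : Decays η φ) (hψ : Decays η ψ) :
    ∃ C : ℝ, ∀ t ≤ 0, ‖(φ t).1 - (ψ t).1‖ + ‖(φ t).2 - (ψ t).2‖ ≤ C * Real.exp (η * t) := by
  obtain ⟨C, hC⟩ := hφ
  obtain ⟨D, hD⟩ := hψ
  refine ⟨C + D, fun t ht => ?_⟩
  have := hC t ht
  have := hD t ht
  have := norm_sub_le (φ t).1 (ψ t).1
  have := norm_sub_le (φ t).2 (ψ t).2
  linarith

/-- Insert the supremum `M` itself as the bound: `M ≤ D + κ M`, where finiteness of `M` permits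
solving for it. -/
theorem le_of_forall_bound_improves {ι : Type*} {f : ι → ℝ} {κ D : ℝ} (hκ : κ < 1)
    (hb : ∃ C, ∀ i, f i ≤ C) (himp : ∀ C, (∀ i, f i ≤ C) → ∀ i, f i ≤ D + κ * C) (i : ι) :
    f i ≤ D / (1 - κ) := by
  have hbdd : BddAbove (range f) := by
    obtain ⟨C, hC⟩ := hb
    exact ⟨C, by rintro _ ⟨i, rfl⟩; exact hC i⟩
  have : Nonempty ι := ⟨i⟩
  have h1 : ⨆ i, f i ≤ D + κ * ⨆ i, f i := ciSup_le (himp _ fun i => le_ciSup hbdd i)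
  refine (le_ciSup hbdd i).trans ?_
  rw [le_div_iff₀ (sub_pos.2 hκ)]
  linarith

theorem IsLP.norm_sub_le (hT : T.IsLip K) (hd : T.HasDichotomy a b)
    (hbη : b < η) (hηa : η < a) (hgap : K * (1 / (η - b) + 1 / (a - η)) < 1) {u₀ u₁ : V}
    (hφ : T.IsLP η u₀ φ) (hψ : T.IsLP η u₁ ψ) {t : ℝ} (ht : t ≤ 0) :
    ‖(φ t).1 - (ψ t).1‖ + ‖(φ t).2 - (ψ t).2‖
      ≤ ‖u₀ - u₁‖ / (1 - K * (1 / (η - b) + 1 / (a - η))) * Real.exp (η * t) := by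
  have key := le_of_forall_bound_improves (ι := Iic (0 : ℝ)) hgap (D := ‖u₀ - u₁‖)
    (f := fun t => (‖(φ t).1 - (ψ t).1‖ + ‖(φ t).2 - (ψ t).2‖) / Real.exp (η * t))
    (by
      obtain ⟨C, hC⟩ := hφ.decays.sub hψ.decays
      exact ⟨C, fun t => (div_le_iff₀ (Real.exp_pos _)).2 (hC t t.2)⟩)
    (by
      intro C hC t
      rw [div_le_iff₀ (Real.exp_pos _), hφ.eq t t.2, hψ.eq t t.2]
      exact hT.norm_lpMap_sub_le hd hbη hηa hφ.cont hψ.cont hφ.decays hψ.decays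
        (fun s hs => (div_le_iff₀ (Real.exp_pos _)).1 (hC ⟨s, hs⟩)) t.2)
  exact (div_le_iff₀ (Real.exp_pos _)).1 (key ⟨t, ht⟩)

/-- The global estimate `‖u₀ - u₁‖ / (1 - κ)` for the difference is fed once more through the
`v`-equation, which contributes the factor `K / (η - b)`. -/
theorem IsLP.norm_snd_zero_sub_le (hT : T.IsLip K) (hd : T.HasDichotomy a b)
    (hbη : b < η) (hηa : η < a) (hgap : K * (1 / (η - b) + 1 / (a - η)) < 1) {u₀ u₁ : V}
    (hφ : T.IsLP η u₀ φ) (hψ : T.IsLP η u₁ ψ) :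
    ‖(φ 0).2 - (ψ 0).2‖
      ≤ K / ((η - b) * (1 - K * (1 / (η - b) + 1 / (a - η)))) * ‖u₀ - u₁‖ := by
  have := hT.norm_lpMap_snd_sub_le hd hbη hφ.cont hψ.cont hφ.decays hψ.decays (u₀ := u₀)
    (u₁ := u₁) (fun t ht => hφ.norm_sub_le hT hd hbη hηa hgap hψ ht) le_rfl
  rw [← hφ.eq 0 le_rfl, ← hψ.eq 0 le_rfl, mul_zero, Real.exp_zero, mul_one] at this
  refine this.trans_eq ?_
  rw [← mul_div_assoc, div_div, mul_comm (η - b), mul_div_right_comm]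

theorem IsLP.eqOn (hT : T.IsLip K) (hd : T.HasDichotomy a b)
    (hbη : b < η) (hηa : η < a) (hgap : K * (1 / (η - b) + 1 / (a - η)) < 1) {u₀ : V}
    (hφ : T.IsLP η u₀ φ) (hψ : T.IsLP η u₀ ψ) : EqOn φ ψ (Iic 0) := by
  intro t ht
  have := hφ.norm_sub_le hT hd hbη hηa hgap hψ ht
  rw [sub_self, norm_zero, zero_div, zero_mul] at this
  have h1 := norm_nonneg ((φ t).1 - (ψ t).1)
  have h2 := norm_nonneg ((φ t).2 - (ψ t).2)
  exact Prod.ext (sub_eq_zero.1 (norm_le_zero_iff.1 (by linarith)))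
    (sub_eq_zero.1 (norm_le_zero_iff.1 (by linarith)))

theorem IsLP.fst_zero {u₀ : V} (hφ : T.IsLP η u₀ φ) : (φ 0).1 = u₀ := by
  rw [hφ.eq 0 le_rfl]
  simp [lpMap, NormedSpace.exp_zero]

theorem IsLP.isOrbitOn (hT : T.IsLip K) (hd : T.HasDichotomy a b) (hbη : b < η) {u₀ : V}
    (hφ : T.IsLP η u₀ φ) : T.IsOrbitOn (Iic 0) φ := by
  have heq1 : ∀ t ≤ 0, (φ t).1 =
      𝔢 (t • T.A) (u₀ + ∫ s in (0 : ℝ)..t, 𝔢 ((-s) • T.A) (T.h s (φ s))) := fun t ht =>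
    congrArg Prod.fst ((hφ.eq t ht).trans (hT.lpMap_eq hd hbη hφ.cont hφ.decays u₀ ht))
  have heq2 : ∀ t ≤ 0, (φ t).2 =
      𝔢 (t • T.B) ((∫ s in Iic (0 : ℝ), 𝔢 ((-s) • T.B) (T.k s (φ s))) +
        ∫ s in (0 : ℝ)..t, 𝔢 ((-s) • T.B) (T.k s (φ s))) := fun t ht =>
    congrArg Prod.snd ((hφ.eq t ht).trans (hT.lpMap_eq hd hbη hφ.cont hφ.decays u₀ ht))
  refine ⟨hφ.cont, fun t ht => ?_, fun t ht => ?_⟩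
  · have hg := hT.tame_h hφ.cont
    rw [(hT.tame_fst hφ.cont).integral_eq_sub (f := fun u => 𝔢 (u • T.A)
      (u₀ + ∫ s in (0 : ℝ)..u, 𝔢 ((-s) • T.A) (T.h s (φ s))))]
    · rw [← heq1 t ht, ← heq1 0 le_rfl]
      abel
    · exact (exp_smul_continuous T.A).clm_apply
        (continuous_const.add ((tame_exp_neg_apply T.A hg).continuous_integral 0))
    · intro x hx
      rw [max_eq_left ht] at hx
      have := hasDerivWithinAt_variation_of_constants T.A hg u₀ 0 x
      rwa [← heq1 x hx.2.le] at this
  · have hg := hT.tame_k hφ.cont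
    rw [(hT.tame_snd hφ.cont).integral_eq_sub (f := fun u => 𝔢 (u • T.B)
      ((∫ s in Iic (0 : ℝ), 𝔢 ((-s) • T.B) (T.k s (φ s))) +
        ∫ s in (0 : ℝ)..u, 𝔢 ((-s) • T.B) (T.k s (φ s))))]
    · rw [← heq2 t ht, ← heq2 0 le_rfl]
      abel
    · exact (exp_smul_continuous T.B).clm_apply
        (continuous_const.add ((tame_exp_neg_apply T.B hg).continuous_integral 0))
    · intro x hx
      rw [max_eq_left ht] at hx
      have := hasDerivWithinAt_variation_of_constants T.B hg
        (∫ s in Iic (0 : ℝ), 𝔢 ((-s) • T.B) (T.k s (φ s))) 0 x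
      rwa [← heq2 x hx.2.le] at this

/-- Decay selects the integral equations: `u` is represented from time `0`, while `v` is represented
from a time `s` that is sent to `-∞`. -/
theorem IsOrbitOn.isLP (hT : T.IsLip K) (hd : T.HasDichotomy a b) (hbη : b < η)
    (hφ : T.IsOrbitOn (Iic 0) φ) (hdec : Decays η φ) : T.IsLP η (φ 0).1 φ := by
  refine ⟨hφ.cont, hdec, fun t ht => Prod.ext ?_ ?_⟩
  · have h := eq_variation_of_constants T.A (c := 0) (t := t) (g := fun s => T.h s (φ s))
      -- `φ` satisfies the equation only on `(-∞, 0]`; this primitive agrees with it there and has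
      -- the required right derivative at every time.
      (f := fun t => (φ 0).1 + ∫ s in (0 : ℝ)..t, (T.A (φ s).1 + T.h s (φ s)))
      (continuous_const.add ((hT.tame_fst hφ.cont).continuous_integral 0)) (hT.tame_h hφ.cont)
      (fun x hx => by
        rw [max_eq_left ht] at hx
        have := ((hT.tame_fst hφ.cont).hasDerivWithinAt_integral 0 x).const_add (φ 0).1
        rwa [← hφ.eq_fst x hx.2.le])
    simpa [lpMap, ← hφ.eq_fst t ht] using h
  · have h : ∀ s ≤ t, (φ t).2 = 𝔢 ((t - s) • T.B) (φ s).2 +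
        ∫ r in s..t, 𝔢 ((t - r) • T.B) (T.k r (φ r)) := by
      intro s hs
      have h := eq_variation_of_constants T.B (c := s) (t := t) (g := fun s => T.k s (φ s))
        (f := fun t => (φ 0).2 + ∫ s in (0 : ℝ)..t, (T.B (φ s).2 + T.k s (φ s)))
        (continuous_const.add ((hT.tame_snd hφ.cont).continuous_integral 0)) (hT.tame_k hφ.cont)
        (fun x hx => by
          rw [max_eq_right hs] at hx
          have := ((hT.tame_snd hφ.cont).hasDerivWithinAt_integral 0 x).const_add (φ 0).2
          rwa [← hφ.eq_snd x (hx.2.le.trans ht)])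
      rwa [← hφ.eq_snd t ht, ← hφ.eq_snd s (hs.trans ht)] at h
    -- The boundary term is at most `C e^{b(t-s)} e^{ηs}`, which vanishes as `s → -∞` because `b <
    -- η`.
    have h1 : Tendsto (fun s => 𝔢 ((t - s) • T.B) (φ s).2) atBot (𝓝 0) := by
      obtain ⟨C, hC⟩ := hdec
      refine squeeze_zero_norm' (a := fun s => C * Real.exp (b * t) * Real.exp ((η - b) * s)) ?_ ?_
      · filter_upwards [eventually_le_atBot t] with s hs
        refine (hd.bound_B (t - s) (sub_nonneg.2 hs) _).trans ?_
        have h3 := (le_add_of_nonneg_left (norm_nonneg (φ s).1)).trans (hC s (hs.trans ht))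
        refine (mul_le_mul_of_nonneg_left h3 (Real.exp_nonneg _)).trans_eq ?_
        rw [mul_left_comm, mul_assoc, ← Real.exp_add, ← Real.exp_add]
        ring_nf
      · rw [← mul_zero (C * Real.exp (b * t))]
        exact tendsto_const_nhds.mul
          (Real.tendsto_exp_atBot.comp (tendsto_id.const_mul_atBot (sub_pos.2 hbη)))
    have h2 : Tendsto (fun s => ∫ r in s..t, 𝔢 ((t - r) • T.B) (T.k r (φ r))) atBot
        (𝓝 (∫ r in Iic t, 𝔢 ((t - r) • T.B) (T.k r (φ r)))) :=
      intervalIntegral_tendsto_integral_Iic _ (hT.integrableOn_lp hd hbη hφ.cont hdec ht) tendsto_id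
    refine tendsto_nhds_unique (f := fun _ : ℝ => (φ t).2) (l := atBot) tendsto_const_nhds ?_
    have h3 := h1.add h2
    rw [zero_add] at h3
    refine h3.congr' ?_
    filter_upwards [eventually_le_atBot t] with s hs using (h s hs).symm

end SplitSystem

/-! ### The stationary Ornstein–Uhlenbeck process along a path of sublinear growth -/

section Path

variable {ω : PathSpace}

theorem exists_growth_bound (hω : Tendsto (fun t : ℝ => ω t / t) atBot (𝓝 0)) {ε : ℝ} (hε : 0 < ε) :
    ∃ C, ∀ s ≤ 0, |ω s| ≤ C + ε * |s| := by
  have h1 : ∀ᶠ s in atBot, |ω s / s| < ε := by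
    have := hω.abs
    rw [abs_zero] at this
    exact this.eventually (gt_mem_nhds hε)
  obtain ⟨R, hR⟩ := eventually_atBot.1 h1
  obtain ⟨C, hC⟩ := ω.2.1.tame.locBdd |min R 0|
  refine ⟨max C 0, fun s hs => ?_⟩
  rcases le_or_gt s R with h | h
  · rcases eq_or_ne s 0 with rfl | h0
    · have : ω 0 = 0 := ω.2.2
      simp [this]
    · have := hR s h
      rw [abs_div, div_lt_iff₀ (abs_pos.2 h0)] at this
      linarith [le_max_right C 0]
  · have h2 : |s| ≤ |min R 0| := by
      rw [abs_of_nonpos hs, abs_of_nonpos (min_le_right R 0)]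
      exact neg_le_neg ((min_le_left _ _).trans h.le)
    have := hC s h2
    rw [Real.norm_eq_abs] at this
    have h3 : 0 ≤ ε * |s| := by positivity
    linarith [le_max_left C 0]

theorem integrableOn_exp_mul_abs : IntegrableOn (fun s : ℝ => Real.exp s * |s|) (Iic 0) := by
  have h := (integrableOn_exp_mul_Iic (a := 1 / 2) (by norm_num) 0).const_mul 2
  refine Integrable.mono' h (by fun_prop) ?_
  refine (ae_restrict_iff' measurableSet_Iic).2 (Eventually.of_forall fun s hs => ?_)
  have h1 : -s / 2 + 1 ≤ Real.exp (-s / 2) := Real.add_one_le_exp _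
  have h2 : Real.exp s * Real.exp (-s / 2) = Real.exp (1 / 2 * s) := by
    rw [← Real.exp_add]; ring_nf
  rw [Real.norm_of_nonneg (by positivity), abs_of_nonpos hs, ← h2, ← mul_assoc, mul_comm 2,
    mul_assoc]
  exact mul_le_mul_of_nonneg_left (by linarith) (Real.exp_nonneg _)

theorem tame_exp_mul (ω : PathSpace) : Tame fun s => Real.exp s * ω s :=
  Real.continuous_exp.tame.mul ω.2.1.tame

/-- The moving average `∫_{-∞}^0 e^τ ω(τ + t) dτ`. -/
def movingAvg (ω : PathSpace) (t : ℝ) : ℝ := ∫ τ in Iic (0 : ℝ), Real.exp τ * ω (τ + t)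

theorem integrableOn_exp_mul_path (hω : Tendsto (fun t : ℝ => ω t / t) atBot (𝓝 0)) (t : ℝ) :
    IntegrableOn (fun s => Real.exp s * ω s) (Iic t) := by
  have h0 : IntegrableOn (fun s => Real.exp s * ω s) (Iic 0) := by
    obtain ⟨C, hC⟩ := exists_growth_bound hω one_pos
    refine Integrable.mono' (((integrableOn_exp_Iic 0).const_mul C).add integrableOn_exp_mul_abs)
      (tame_exp_mul ω).stronglyMeasurable.aestronglyMeasurable ?_
    refine (ae_restrict_iff' measurableSet_Iic).2 (Eventually.of_forall fun s hs => ?_)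
    rw [norm_mul, Real.norm_of_nonneg (Real.exp_nonneg _), Real.norm_eq_abs]
    refine (mul_le_mul_of_nonneg_left (hC s hs) (Real.exp_nonneg _)).trans_eq ?_
    simp only [Pi.add_apply]
    ring
  rcases le_total t 0 with h | h
  · exact h0.mono_set (Iic_subset_Iic.2 h)
  · rw [← Iic_union_Ioc_eq_Iic h]
    refine h0.union ?_
    have := (tame_exp_mul ω).intervalIntegrable 0 t
    rwa [intervalIntegrable_iff, uIoc_of_le h] at this

theorem setIntegral_Iic_comp_add (f : ℝ → ℝ) (t : ℝ) :
    ∫ τ in Iic (0 : ℝ), f (τ + t) = ∫ σ in Iic t, f σ := by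
  have := (measurePreserving_add_right volume t).setIntegral_preimage_emb
    (measurableEmbedding_addRight t) f (Iic t)
  simpa using this

theorem integrableOn_Iic_comp_add {f : ℝ → ℝ} {t : ℝ} (hf : IntegrableOn f (Iic t)) :
    IntegrableOn (fun τ => f (τ + t)) (Iic 0) := by
  have := ((measurePreserving_add_right volume t).integrableOn_comp_preimage
    (measurableEmbedding_addRight t)).2 hf
  simpa [Function.comp_def] using! this

theorem exp_mul_shift_eq (ω : PathSpace) (t : ℝ) :
    (fun τ => Real.exp τ * ω (τ + t)) =
      fun τ => Real.exp (-t) * (Real.exp (τ + t) * ω (τ + t)) := by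
  funext τ
  rw [← mul_assoc, ← Real.exp_add]
  ring_nf

theorem movingAvg_eq (hω : Tendsto (fun t : ℝ => ω t / t) atBot (𝓝 0)) (t : ℝ) :
    movingAvg ω t = Real.exp (-t) * ((∫ s in Iic (0 : ℝ), Real.exp s * ω s) +
      ∫ s in (0 : ℝ)..t, Real.exp s * ω s) := by
  rw [movingAvg, exp_mul_shift_eq, integral_const_mul,
    setIntegral_Iic_comp_add (fun s => Real.exp s * ω s),
    ← intervalIntegral.integral_Iic_sub_Iic (integrableOn_exp_mul_path hω 0)
      (integrableOn_exp_mul_path hω t)]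
  ring

theorem integrableOn_movingAvg (hω : Tendsto (fun t : ℝ => ω t / t) atBot (𝓝 0)) (t : ℝ) :
    IntegrableOn (fun τ => Real.exp τ * ω (τ + t)) (Iic 0) := by
  rw [exp_mul_shift_eq]
  exact (integrableOn_Iic_comp_add (integrableOn_exp_mul_path hω t)).const_mul _

theorem continuous_movingAvg (hω : Tendsto (fun t : ℝ => ω t / t) atBot (𝓝 0)) :
    Continuous (movingAvg ω) := by
  rw [funext (movingAvg_eq hω)]
  exact (Real.continuous_exp.comp continuous_neg).mul
    (continuous_const.add ((tame_exp_mul ω).continuous_integral 0))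

/-- Since `∫_{-∞}^0 e^τ dτ = 1`, the shift merely subtracts `ω(t)` from the average. The jumps of
`z(θ_t ω)` are therefore those of `ω`, the moving average being continuous. -/
theorem z_shift_eq (hω : Tendsto (fun t : ℝ => ω t / t) atBot (𝓝 0)) (t : ℝ) :
    z (shift t ω) = ω t - movingAvg ω t := by
  have h1 : z (shift t ω) = -∫ τ in Iic (0 : ℝ), (Real.exp τ * ω (τ + t) - Real.exp τ * ω t) := by
    simp only [z, ← mul_sub]
    rfl
  rw [h1, integral_sub (integrableOn_movingAvg hω t) ((integrableOn_exp_Iic 0).mul_const _),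
    integral_mul_const, integral_exp_Iic_zero, movingAvg]
  ring

theorem tame_z_shift (hω : Tendsto (fun t : ℝ => ω t / t) atBot (𝓝 0)) :
    Tame fun t => z (shift t ω) := by
  rw [funext (z_shift_eq hω)]
  exact ω.2.1.tame.sub (continuous_movingAvg hω).tame

/-- The moving average `M` satisfies `M' = ω - M` from the right, and `ω - M` is `z(θ_t ω)`. -/
theorem zInt_zero_eq (hω : Tendsto (fun t : ℝ => ω t / t) atBot (𝓝 0)) (t : ℝ) :
    zInt ω 0 t = movingAvg ω t - movingAvg ω 0 := by
  refine (tame_z_shift hω).integral_eq_sub (continuous_movingAvg hω) fun x _ => ?_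
  have h1 : HasDerivAt (fun t : ℝ => Real.exp (-t)) (-Real.exp (-x)) x := by
    simpa using (hasDerivAt_neg x).exp
  have h2 := h1.hasDerivWithinAt.mul
    (((tame_exp_mul ω).hasDerivWithinAt_integral 0 x).const_add
      (∫ s in Iic (0 : ℝ), Real.exp s * ω s))
  rw [z_shift_eq hω, movingAvg_eq hω x, funext (movingAvg_eq hω)]
  convert! h2 using 1
  rw [← mul_assoc (Real.exp (-x)) (Real.exp x), ← Real.exp_add, neg_add_cancel,
    Real.exp_zero]
  ring

/-- Averaging against `e^τ` preserves sublinear growth: insert `|ω(s+t)| ≤ C + ε|s| + ε|t|` and use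
that `e^s |s|` is integrable. -/
theorem zInt_growth (hω : Tendsto (fun t : ℝ => ω t / t) atBot (𝓝 0)) {ε : ℝ} (hε : 0 < ε) :
    ∃ C, ∀ t ≤ 0, |zInt ω 0 t| ≤ C + ε * |t| := by
  obtain ⟨C, hC⟩ := exists_growth_bound hω hε
  set M := ∫ s in Iic (0 : ℝ), Real.exp s * |s|
  refine ⟨C + ε * M + |movingAvg ω 0|, fun t ht => ?_⟩
  have hi : IntegrableOn (fun s => Real.exp s * (C + ε * |t|) + ε * (Real.exp s * |s|)) (Iic 0) :=
    ((integrableOn_exp_Iic 0).mul_const _).add (integrableOn_exp_mul_abs.const_mul ε)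
  have h1 : |movingAvg ω t| ≤ C + ε * |t| + ε * M := by
    rw [movingAvg, ← Real.norm_eq_abs]
    refine (norm_integral_le_of_norm_le hi ?_).trans_eq ?_
    · refine (ae_restrict_iff' measurableSet_Iic).2 (Eventually.of_forall fun s hs => ?_)
      rw [norm_mul, Real.norm_of_nonneg (Real.exp_nonneg _), Real.norm_eq_abs]
      have h2 := hC (s + t) (add_nonpos hs ht)
      have h3 : |ω (s + t)| ≤ (C + ε * |t|) + ε * |s| := by
        have := mul_le_mul_of_nonneg_left (abs_add_le s t) hε.le
        linarith
      refine (mul_le_mul_of_nonneg_left h3 (Real.exp_nonneg _)).trans_eq ?_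
      ring
    · rw [integral_add ((integrableOn_exp_Iic 0).mul_const _) (integrableOn_exp_mul_abs.const_mul ε),
        integral_mul_const, integral_const_mul, integral_exp_Iic_zero, one_mul]
  rw [zInt_zero_eq hω]
  have := abs_sub (movingAvg ω t) (movingAvg ω 0)
  linarith

theorem zInt_eq_sub (hz : Tame fun t => z (shift t ω)) (s t : ℝ) :
    zInt ω s t = zInt ω 0 t - zInt ω 0 s :=
  (intervalIntegral.integral_interval_sub_left (hz.intervalIntegrable _ _)
    (hz.intervalIntegrable _ _)).symm

theorem continuous_zInt (hz : Tame fun t => z (shift t ω)) : Continuous (zInt ω 0) :=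
  hz.continuous_integral 0

@[simp]
theorem zInt_self (ω : PathSpace) (s : ℝ) : zInt ω s s = 0 := intervalIntegral.integral_same

end Path

/-- The product rule for an integrating factor, in integrated form. It is used with `ζ = -z` to
remove the multiplicative terms and with `ζ = z` to restore them. -/
theorem exp_integral_smul_eq {V : Type*} [NormedAddCommGroup V] [NormedSpace ℝ V] [CompleteSpace V]
    [SecondCountableTopology V] {ζ : ℝ → ℝ} (hζ : Tame ζ) {x N : ℝ → V} (hN : Tame N)
    (hx : ∀ t, x t = x 0 + ∫ s in (0 : ℝ)..t, N s) (t : ℝ) :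
    Real.exp (∫ s in (0 : ℝ)..t, ζ s) • x t = x 0 + ∫ s in (0 : ℝ)..t,
      (Real.exp (∫ r in (0 : ℝ)..s, ζ r) • N s
        + (ζ s * Real.exp (∫ r in (0 : ℝ)..s, ζ r)) • x s) := by
  have hxc : Continuous x := by
    rw [funext hx]
    exact continuous_const.add (hN.continuous_integral 0)
  have hec : Continuous fun t => Real.exp (∫ s in (0 : ℝ)..t, ζ s) :=
    Real.continuous_exp.comp (hζ.continuous_integral 0)
  have hT : Tame fun s => Real.exp (∫ r in (0 : ℝ)..s, ζ r) • N s
        + (ζ s * Real.exp (∫ r in (0 : ℝ)..s, ζ r)) • x s :=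
    (hec.tame.smul hN).add ((hζ.mul hec.tame).smul hxc.tame)
  rw [hT.integral_eq_sub (hec.smul hxc) (fun u _ => ?_)]
  · simp
  · have h1 : HasDerivWithinAt x (N u) (Ici u) u := by
      rw [funext hx]
      exact (hN.hasDerivWithinAt_integral 0 u).const_add _
    have h2 := (hζ.hasDerivWithinAt_integral 0 u).exp.smul h1
    rw [mul_comm (ζ u)]
    exact h2

namespace Data

variable {n m : ℕ} (S : Data n m)

/-! ### Removing the multiplicative cocycle -/

/-- The system for `e^{-∫_0^t z} p(t)`, which no longer contains the terms `z x`, `z y`. -/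
def transformed (ω : PathSpace) : SplitSystem (E n) (E m) where
  A := S.A
  B := S.B
  h t x := Real.exp (-zInt ω 0 t) •
    S.F (Real.exp (zInt ω 0 t) • x.1) (Real.exp (zInt ω 0 t) • x.2) (shift t ω)
  k t x := Real.exp (-zInt ω 0 t) •
    S.G (Real.exp (zInt ω 0 t) • x.1) (Real.exp (zInt ω 0 t) • x.2) (shift t ω)

theorem continuous_of_lipschitz_sum {V W X : Type*} [NormedAddCommGroup V] [NormedAddCommGroup W]
    [NormedAddCommGroup X] {f : V → W → X} {K : ℝ} (hK : 0 < K)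
    (hf : ∀ x₁ x₂ y₁ y₂, ‖f x₁ y₁ - f x₂ y₂‖ ≤ K * (‖x₁ - x₂‖ + ‖y₁ - y₂‖)) :
    Continuous fun p : V × W => f p.1 p.2 := by
  refine (LipschitzWith.of_dist_le_mul (K := ⟨2 * K, by positivity⟩) fun p q => ?_).continuous
  rw [dist_eq_norm, dist_eq_norm]
  refine (hf _ _ _ _).trans ?_
  change _ ≤ 2 * K * ‖p - q‖
  have h1 := norm_fst_le (p - q)
  have h2 := norm_snd_le (p - q)
  rw [Prod.fst_sub] at h1
  rw [Prod.snd_sub] at h2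
  nlinarith

/-- The two exponential factors cancel, so `K` survives. It is applied twice: to the scaling by `z`
inside `F`, `G`, and to the one by `∫ z` in the transformation. -/
theorem scaled_lipschitz {V W X : Type*} [NormedAddCommGroup V] [NormedSpace ℝ V]
    [NormedAddCommGroup W] [NormedSpace ℝ W] [NormedAddCommGroup X] [NormedSpace ℝ X]
    {f : V → W → X} {K : ℝ}
    (hf : ∀ x₁ x₂ y₁ y₂, ‖f x₁ y₁ - f x₂ y₂‖ ≤ K * (‖x₁ - x₂‖ + ‖y₁ - y₂‖)) (c : ℝ)
    (x₁ x₂ : V) (y₁ y₂ : W) :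
    ‖Real.exp (-c) • f (Real.exp c • x₁) (Real.exp c • y₁) -
      Real.exp (-c) • f (Real.exp c • x₂) (Real.exp c • y₂)‖ ≤ K * (‖x₁ - x₂‖ + ‖y₁ - y₂‖) := by
  rw [← smul_sub, norm_smul, Real.norm_of_nonneg (Real.exp_nonneg _)]
  refine (mul_le_mul_of_nonneg_left (hf _ _ _ _) (Real.exp_nonneg _)).trans_eq ?_
  rw [← smul_sub, ← smul_sub, norm_smul, norm_smul, Real.norm_of_nonneg (Real.exp_nonneg _),
    ← mul_add, mul_left_comm, ← mul_assoc (Real.exp (-c)), ← Real.exp_add, neg_add_cancel,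
    Real.exp_zero, one_mul]

variable {S} {K : ℝ} {ω : PathSpace}

theorem LipschitzCond.transformed (hS : S.LipschitzCond K) (hz : Tame fun t => z (shift t ω)) :
    (S.transformed ω).IsLip K where
  nonneg := hS.K_pos.le
  h_rc p hp t := by
    have hc := continuous_zInt hz
    have hf := continuous_of_lipschitz_sum hS.K_pos hS.f_lip
    have he : ContinuousWithinAt (fun s => Real.exp (z (shift s ω))) (Ici t) t :=
      (hz.rightCont t).rexp
    have he' : ContinuousWithinAt (fun s => Real.exp (-z (shift s ω))) (Ici t) t :=
      (hz.rightCont t).neg.rexp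
    have hZ : Continuous fun s => Real.exp (-zInt ω 0 s) := by fun_prop
    refine hZ.continuousWithinAt.smul (he'.smul ?_)
    refine hf.continuousAt.comp_continuousWithinAt (f := fun s =>
      (Real.exp (z (shift s ω)) • Real.exp (zInt ω 0 s) • (p s).1,
        Real.exp (z (shift s ω)) • Real.exp (zInt ω 0 s) • (p s).2)) ?_
    refine ContinuousWithinAt.prodMk (he.smul ?_) (he.smul ?_) <;> fun_prop
  k_rc p hp t := by
    have hc := continuous_zInt hz
    have hf := continuous_of_lipschitz_sum hS.K_pos hS.g_lip
    have he : ContinuousWithinAt (fun s => Real.exp (z (shift s ω))) (Ici t) t :=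
      (hz.rightCont t).rexp
    have he' : ContinuousWithinAt (fun s => Real.exp (-z (shift s ω))) (Ici t) t :=
      (hz.rightCont t).neg.rexp
    have hZ : Continuous fun s => Real.exp (-zInt ω 0 s) := by fun_prop
    refine hZ.continuousWithinAt.smul (he'.smul ?_)
    refine hf.continuousAt.comp_continuousWithinAt (f := fun s =>
      (Real.exp (z (shift s ω)) • Real.exp (zInt ω 0 s) • (p s).1,
        Real.exp (z (shift s ω)) • Real.exp (zInt ω 0 s) • (p s).2)) ?_
    refine ContinuousWithinAt.prodMk (he.smul ?_) (he.smul ?_) <;> fun_prop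
  h_zero t := by simp [Data.transformed, F, hS.f_zero]
  k_zero t := by simp [Data.transformed, G, hS.g_zero]
  h_lip t p q := scaled_lipschitz (f := fun x y => S.F x y (shift t ω))
    (fun _ _ _ _ => scaled_lipschitz hS.f_lip _ _ _ _ _) _ _ _ _ _
  k_lip t p q := scaled_lipschitz (f := fun x y => S.G x y (shift t ω))
    (fun _ _ _ _ => scaled_lipschitz hS.g_lip _ _ _ _ _) _ _ _ _ _

theorem Dichotomy.transformed {a b : ℝ} (h : S.Dichotomy a b) :
    (S.transformed ω).HasDichotomy a b := ⟨h.bound_A, h.bound_B⟩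

theorem exp_smul_exp_neg_smul {V : Type*} [AddCommGroup V] [Module ℝ V] (c : ℝ) (x : V) :
    Real.exp c • Real.exp (-c) • x = x := by
  rw [smul_smul, ← Real.exp_add, add_neg_cancel, Real.exp_zero, one_smul]

theorem exp_neg_smul_exp_smul {V : Type*} [AddCommGroup V] [Module ℝ V] (c : ℝ) (x : V) :
    Real.exp (-c) • Real.exp c • x = x := by
  rw [smul_smul, ← Real.exp_add, neg_add_cancel, Real.exp_zero, one_smul]

theorem F_eq (x : E n × E m) (t : ℝ) : S.F x.1 x.2 (shift t ω) =
    Real.exp (zInt ω 0 t) • (S.transformed ω).h t (Real.exp (-zInt ω 0 t) • x) := by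
  simp only [Data.transformed, Prod.smul_fst, Prod.smul_snd, exp_smul_exp_neg_smul]

theorem G_eq (x : E n × E m) (t : ℝ) : S.G x.1 x.2 (shift t ω) =
    Real.exp (zInt ω 0 t) • (S.transformed ω).k t (Real.exp (-zInt ω 0 t) • x) := by
  simp only [Data.transformed, Prod.smul_fst, Prod.smul_snd, exp_smul_exp_neg_smul]

/-! ### Solutions of the random system as orbits of the transformed system -/

section Orbits

variable {p : ℝ → E n × E m}

theorem continuous_exp_neg_smul (hz : Tame fun t => z (shift t ω)) (hp : Continuous p) :
    Continuous fun t => Real.exp (-zInt ω 0 t) • p t :=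
  (Real.continuous_exp.comp (continuous_zInt hz).neg).smul hp

theorem tame_rhs_x (hS : S.LipschitzCond K) (hz : Tame fun t => z (shift t ω))
    (hp : Continuous p) : Tame fun s => S.A (p s).1 + S.F (p s).1 (p s).2 (shift s ω) +
      z (shift s ω) • (p s).1 := by
  simp only [F_eq]
  exact ((S.A.continuous.comp hp.fst).tame.add
    ((Real.continuous_exp.comp (continuous_zInt hz)).tame.smul
      ((hS.transformed hz).tame_h (continuous_exp_neg_smul hz hp)))).add (hz.smul hp.fst.tame)

theorem tame_rhs_y (hS : S.LipschitzCond K) (hz : Tame fun t => z (shift t ω))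
    (hp : Continuous p) : Tame fun s => S.B (p s).2 + S.G (p s).1 (p s).2 (shift s ω) +
      z (shift s ω) • (p s).2 := by
  simp only [G_eq]
  exact ((S.B.continuous.comp hp.snd).tame.add
    ((Real.continuous_exp.comp (continuous_zInt hz)).tame.smul
      ((hS.transformed hz).tame_k (continuous_exp_neg_smul hz hp)))).add (hz.smul hp.snd.tame)

theorem IsSolution.apply_zero {p₀ : E n × E m} (hp : S.IsSolution ω p₀ p) : p 0 = p₀ :=
  Prod.ext (by simpa using hp.eq_x 0) (by simpa using hp.eq_y 0)

theorem IsSolution.isOrbitOn (hS : S.LipschitzCond K) (hz : Tame fun t => z (shift t ω))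
    {p₀ : E n × E m} (hp : S.IsSolution ω p₀ p) :
    (S.transformed ω).IsOrbitOn univ fun t => Real.exp (-zInt ω 0 t) • p t := by
  have hneg : ∀ t, ∫ s in (0 : ℝ)..t, -z (shift s ω) = -zInt ω 0 t := fun t =>
    intervalIntegral.integral_neg
  refine ⟨continuous_exp_neg_smul hz hp.cont, fun t _ => ?_, fun t _ => ?_⟩
  · have h := exp_integral_smul_eq hz.neg (tame_rhs_x hS hz hp.cont)
      (x := fun t => (p t).1) (fun t => by rw [hp.apply_zero]; exact hp.eq_x t) t
    simp only [hneg] at h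
    rw [Prod.smul_fst, h]
    simp only [zInt_self, neg_zero, Real.exp_zero, one_smul]
    congr 1
    refine intervalIntegral.integral_congr fun s _ => ?_
    -- The derivative of the integrating factor cancels the term `z x`.
    have h0 : Real.exp (-zInt ω 0 s) • z (shift s ω) • (p s).1 +
        (-z (shift s ω) * Real.exp (-zInt ω 0 s)) • (p s).1 = 0 := by
      rw [smul_smul, ← add_smul, neg_mul, mul_comm, add_neg_cancel, zero_smul]
    simp only [F_eq, smul_add, exp_neg_smul_exp_smul, Prod.smul_fst, map_smul]
    rw [add_assoc, h0, add_zero]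
    rfl
  · have h := exp_integral_smul_eq hz.neg (tame_rhs_y hS hz hp.cont)
      (x := fun t => (p t).2) (fun t => by rw [hp.apply_zero]; exact hp.eq_y t) t
    simp only [hneg] at h
    rw [Prod.smul_snd, h]
    simp only [zInt_self, neg_zero, Real.exp_zero, one_smul]
    congr 1
    refine intervalIntegral.integral_congr fun s _ => ?_
    have h0 : Real.exp (-zInt ω 0 s) • z (shift s ω) • (p s).2 +
        (-z (shift s ω) * Real.exp (-zInt ω 0 s)) • (p s).2 = 0 := by
      rw [smul_smul, ← add_smul, neg_mul, mul_comm, add_neg_cancel, zero_smul]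
    simp only [G_eq, smul_add, exp_neg_smul_exp_smul, Prod.smul_snd, map_smul]
    rw [add_assoc, h0, add_zero]
    rfl

theorem isSolution_of_isOrbitOn (hS : S.LipschitzCond K) (hz : Tame fun t => z (shift t ω))
    {q : ℝ → E n × E m} (hq : (S.transformed ω).IsOrbitOn univ q) :
    S.IsSolution ω (q 0) fun t => Real.exp (zInt ω 0 t) • q t := by
  have hc : Continuous fun t => Real.exp (zInt ω 0 t) • q t :=
    (Real.continuous_exp.comp (continuous_zInt hz)).smul hq.cont
  refine ⟨hc, fun t => (tame_rhs_x hS hz hc).intervalIntegrable _ _,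
    fun t => (tame_rhs_y hS hz hc).intervalIntegrable _ _, fun t => ?_, fun t => ?_⟩
  · have h := exp_integral_smul_eq hz ((hS.transformed hz).tame_fst hq.cont)
      (x := fun t => (q t).1) (fun t => hq.eq_fst t trivial) t
    rw [Prod.smul_fst]
    refine h.trans ?_
    congr 1
    refine intervalIntegral.integral_congr fun s _ => ?_
    beta_reduce
    rw [F_eq (Real.exp (zInt ω 0 s) • q s), exp_neg_smul_exp_smul]
    simp only [Prod.smul_fst, map_smul, smul_smul, smul_add]
    rfl
  · have h := exp_integral_smul_eq hz ((hS.transformed hz).tame_snd hq.cont)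
      (x := fun t => (q t).2) (fun t => hq.eq_snd t trivial) t
    rw [Prod.smul_snd]
    refine h.trans ?_
    congr 1
    refine intervalIntegral.integral_congr fun s _ => ?_
    beta_reduce
    rw [G_eq (Real.exp (zInt ω 0 s) • q s), exp_neg_smul_exp_smul]
    simp only [Prod.smul_snd, map_smul, smul_smul, smul_add]
    rfl

theorem existsUnique_isSolution (hS : S.LipschitzCond K) (hz : Tame fun t => z (shift t ω))
    (p₀ : E n × E m) : ∃! p, S.IsSolution ω p₀ p := by
  obtain ⟨q, hq, rfl⟩ := (hS.transformed hz).exists_orbit p₀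
  refine ⟨_, isSolution_of_isOrbitOn hS hz hq, fun p hp => funext fun t => ?_⟩
  have := (hp.isOrbitOn hS hz).eqOn (hS.transformed hz) (fun _ _ => subset_univ _) hq
    (by simp [hp.apply_zero]) (mem_univ t)
  simp only [← this, exp_smul_exp_neg_smul]

/-- `flow` is an `epsilon` choice; existence of a solution is what gives it meaning. -/
theorem flow_isSolution (hS : S.LipschitzCond K) (hz : Tame fun t => z (shift t ω))
    (p₀ : E n × E m) : S.IsSolution ω p₀ fun t => S.flow t ω p₀ :=
  Classical.epsilon_spec (existsUnique_isSolution hS hz p₀).exists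

variable (S ω) in
/-- The orbits of the transformed system. -/
def tflow (p₀ : E n × E m) (t : ℝ) : E n × E m := Real.exp (-zInt ω 0 t) • S.flow t ω p₀

theorem tflow_isOrbitOn (hS : S.LipschitzCond K) (hz : Tame fun t => z (shift t ω))
    (p₀ : E n × E m) : (S.transformed ω).IsOrbitOn univ (S.tflow ω p₀) :=
  (flow_isSolution hS hz p₀).isOrbitOn hS hz

theorem tflow_zero (hS : S.LipschitzCond K) (hz : Tame fun t => z (shift t ω))
    (p₀ : E n × E m) : S.tflow ω p₀ 0 = p₀ := by
  simp [tflow, (flow_isSolution hS hz p₀).apply_zero]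

end Orbits
end Data

/-! ### The space `C_η^-` in transformed coordinates -/

theorem SplitSystem.IsOrbitOn.mono {V W : Type*} [NormedAddCommGroup V]
    [NormedSpace ℝ V] [NormedAddCommGroup W] [NormedSpace ℝ W] {T : SplitSystem V W}
    {I J : Set ℝ} {p : ℝ → V × W} (h : T.IsOrbitOn J p) (hIJ : I ⊆ J) : T.IsOrbitOn I p :=
  ⟨h.cont, fun t ht => h.eq_fst t (hIJ ht), fun t ht => h.eq_snd t (hIJ ht)⟩

theorem SplitSystem.Decays.congr {V W : Type*} [NormedAddCommGroup V]
    [NormedSpace ℝ V] [NormedAddCommGroup W] [NormedSpace ℝ W] {η : ℝ} {φ ψ : ℝ → V × W}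
    (h : SplitSystem.Decays η φ) (he : EqOn φ ψ (Iic 0)) : SplitSystem.Decays η ψ := by
  obtain ⟨C, hC⟩ := h
  exact ⟨C, fun t ht => by rw [← he ht]; exact hC t ht⟩

theorem memCminus_iff {k : ℕ} {η : ℝ} {ω : PathSpace} {φ : ℝ → E k} :
    MemCminus η ω φ ↔ ContinuousOn φ (Iic 0) ∧
      ∃ C, ∀ t ≤ 0, ‖Real.exp (-zInt ω 0 t) • φ t‖ ≤ C * Real.exp (η * t) := by
  refine and_congr_right fun _ => ⟨?_, ?_⟩
  · rintro ⟨C, hC⟩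
    refine ⟨C, fun t ht => ?_⟩
    have := hC ⟨t, ht, rfl⟩
    simp only at this
    rw [sub_eq_add_neg, Real.exp_add, mul_assoc, neg_mul, Real.exp_neg (η * t),
      inv_mul_le_iff₀ (Real.exp_pos _)] at this
    rwa [norm_smul, Real.norm_of_nonneg (Real.exp_nonneg _), mul_comm C]
  · rintro ⟨C, hC⟩
    refine ⟨C, ?_⟩
    rintro _ ⟨t, ht, rfl⟩
    have := hC t ht
    simp only
    rw [sub_eq_add_neg, Real.exp_add, mul_assoc, neg_mul, Real.exp_neg (η * t),
      inv_mul_le_iff₀ (Real.exp_pos _)]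
    rwa [norm_smul, Real.norm_of_nonneg (Real.exp_nonneg _), mul_comm C] at this

theorem memCminus_fst_snd_iff {n m : ℕ} {η : ℝ} {ω : PathSpace} {φ : ℝ → E n × E m} :
    MemCminus η ω (fun t => (φ t).1) ∧ MemCminus η ω (fun t => (φ t).2) ↔
      ContinuousOn φ (Iic 0) ∧
        SplitSystem.Decays η (fun t => Real.exp (-zInt ω 0 t) • φ t) := by
  rw [memCminus_iff, memCminus_iff]
  constructor
  · rintro ⟨⟨h1, C, hC⟩, h2, D, hD⟩
    refine ⟨h1.prodMk h2, C + D, fun t ht => ?_⟩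
    rw [add_mul]
    exact add_le_add (hC t ht) (hD t ht)
  · rintro ⟨h, C, hC⟩
    exact ⟨⟨h.fst, C, fun t ht => (le_add_of_nonneg_right (norm_nonneg _)).trans (hC t ht)⟩,
      h.snd, C, fun t ht => (le_add_of_nonneg_left (norm_nonneg _)).trans (hC t ht)⟩

namespace Data

variable {n m : ℕ} {S : Data n m} {K : ℝ} {ω : PathSpace} {η : ℝ}

/-! ### Fibers and the Lyapunov–Perron system in transformed coordinates -/

theorem mem_fiber_iff (hS : S.LipschitzCond K) (hz : Tame fun t => z (shift t ω))
    {p₀ q₀ : E n × E m} : q₀ ∈ S.fiber η p₀ ω ↔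
      SplitSystem.Decays η fun t => S.tflow ω q₀ t - S.tflow ω p₀ t := by
  have h := memCminus_fst_snd_iff (η := η) (ω := ω)
    (φ := fun t => S.flow t ω p₀ - S.flow t ω q₀)
  have hc : Continuous fun t => S.flow t ω p₀ - S.flow t ω q₀ :=
    (flow_isSolution hS hz p₀).cont.sub (flow_isSolution hS hz q₀).cont
  have key : ∀ t, Real.exp (-zInt ω 0 t) • (S.flow t ω p₀ - S.flow t ω q₀) =
      -(S.tflow ω q₀ t - S.tflow ω p₀ t) := fun t => by simp only [tflow, smul_sub, neg_sub]
  simp only [key, SplitSystem.Decays, Prod.fst_neg, Prod.snd_neg, norm_neg] at h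
  exact h.trans (and_iff_right hc.continuousOn)

variable (S ω) in
/-- The transformed system of differences from the orbit through `p₀`. -/
abbrev diffSystem (p₀ : E n × E m) : SplitSystem (E n) (E m) :=
  (S.transformed ω).diff (S.tflow ω p₀)

theorem deltaF_eq (p₀ : E n × E m) (s : ℝ) (x : E n × E m) :
    S.deltaF ω p₀ s x.1 x.2 =
      Real.exp (zInt ω 0 s) • (S.diffSystem ω p₀).h s (Real.exp (-zInt ω 0 s) • x) := by
  simp only [deltaF, SplitSystem.diff, smul_sub]
  rw [F_eq (S.flow s ω p₀), ← Prod.fst_add, ← Prod.snd_add, F_eq (x + S.flow s ω p₀), smul_add]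
  rfl

theorem deltaG_eq (p₀ : E n × E m) (s : ℝ) (x : E n × E m) :
    S.deltaG ω p₀ s x.1 x.2 =
      Real.exp (zInt ω 0 s) • (S.diffSystem ω p₀).k s (Real.exp (-zInt ω 0 s) • x) := by
  simp only [deltaG, SplitSystem.diff, smul_sub]
  rw [G_eq (S.flow s ω p₀), ← Prod.fst_add, ← Prod.snd_add, G_eq (x + S.flow s ω p₀), smul_add]
  rfl

/-- The additivity `∫_s^t z + ∫_0^s z = ∫_0^t z` combines the two exponentials into a factor
independent of `s`, which can leave the integral. -/
theorem integrand_u_eq (hz : Tame fun t => z (shift t ω)) (p₀ : E n × E m) (s t : ℝ)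
    (x : E n × E m) :
    Real.exp (zInt ω s t) • NormedSpace.exp ((t - s) • S.A) (S.deltaF ω p₀ s x.1 x.2) =
      Real.exp (zInt ω 0 t) • NormedSpace.exp ((t - s) • (S.diffSystem ω p₀).A)
        ((S.diffSystem ω p₀).h s (Real.exp (-zInt ω 0 s) • x)) := by
  rw [deltaF_eq, map_smul, smul_smul, ← Real.exp_add, zInt_eq_sub hz s t, sub_add_cancel]
  rfl

theorem integrand_v_eq (hz : Tame fun t => z (shift t ω)) (p₀ : E n × E m) (s t : ℝ)
    (x : E n × E m) :
    Real.exp (zInt ω s t) • NormedSpace.exp ((t - s) • S.B) (S.deltaG ω p₀ s x.1 x.2) =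
      Real.exp (zInt ω 0 t) • NormedSpace.exp ((t - s) • (S.diffSystem ω p₀).B)
        ((S.diffSystem ω p₀).k s (Real.exp (-zInt ω 0 s) • x)) := by
  rw [deltaG_eq, map_smul, smul_smul, ← Real.exp_add, zInt_eq_sub hz s t, sub_add_cancel]
  rfl

/-- The right-hand side of the original Lyapunov–Perron system in transformed coordinates. -/
theorem lp_rhs_eq (hz : Tame fun t => z (shift t ω)) (p₀ : E n × E m) (u₀ : E n)
    (φ : ℝ → E n × E m) (t : ℝ) :
    (Real.exp (zInt ω 0 t) • NormedSpace.exp (t • S.A) u₀ + ∫ s in (0 : ℝ)..t,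
        Real.exp (zInt ω s t) •
          NormedSpace.exp ((t - s) • S.A) (S.deltaF ω p₀ s (φ s).1 (φ s).2),
      ∫ s in Iic t, Real.exp (zInt ω s t) •
        NormedSpace.exp ((t - s) • S.B) (S.deltaG ω p₀ s (φ s).1 (φ s).2)) =
    Real.exp (zInt ω 0 t) •
      (S.diffSystem ω p₀).lpMap u₀ (fun s => Real.exp (-zInt ω 0 s) • φ s) t := by
  simp only [integrand_u_eq hz, integrand_v_eq hz, intervalIntegral.integral_smul, integral_smul]
  rw [← smul_add]
  rfl

/-- The original system constrains `φ` only on `(-∞, 0]`; freezing it at time `0` supplies the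
continuity on `ℝ` that `IsLP` demands. -/
theorem IsLPSolution.isLP (hz : Tame fun t => z (shift t ω)) {p₀ : E n × E m} {u₀ : E n}
    {φ : ℝ → E n × E m} (hφ : S.IsLPSolution η ω p₀ u₀ φ) :
    (S.diffSystem ω p₀).IsLP η u₀
      fun t => Real.exp (-zInt ω 0 (min t 0)) • φ (min t 0) := by
  obtain ⟨hc, hd⟩ := memCminus_fst_snd_iff.1 ⟨hφ.mem_u, hφ.mem_v⟩
  have hm : Continuous fun t : ℝ => min t 0 := by fun_prop
  have he : EqOn (fun t => Real.exp (-zInt ω 0 t) • φ t)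
      (fun t => Real.exp (-zInt ω 0 (min t 0)) • φ (min t 0)) (Iic 0) := fun t ht => by
    simp only [min_eq_left (mem_Iic.1 ht)]
  refine ⟨?_, hd.congr he, fun t ht => ?_⟩
  · exact (Real.continuous_exp.comp ((continuous_zInt hz).comp hm).neg).smul
      (hc.comp_continuous hm fun t => min_le_right t 0)
  · rw [← SplitSystem.lpMap_congr he ht]
    simp only [min_eq_left ht]
    rw [Prod.ext (hφ.eq_u t ht) (hφ.eq_v t ht) (y := (_, _)), lp_rhs_eq hz, exp_neg_smul_exp_smul]

theorem isLPSolution_of_isLP (hS : S.LipschitzCond K) (hz : Tame fun t => z (shift t ω))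
    {a b : ℝ} (hA : S.Dichotomy a b) (hbη : b < η) {p₀ : E n × E m} {u₀ : E n}
    {ψ : ℝ → E n × E m} (hψ : (S.diffSystem ω p₀).IsLP η u₀ ψ) :
    S.IsLPSolution η ω p₀ u₀ fun t => Real.exp (zInt ω 0 t) • ψ t := by
  have hT : (S.diffSystem ω p₀).IsLip K :=
    (hS.transformed hz).diff (tflow_isOrbitOn hS hz p₀).cont
  have hd : (S.diffSystem ω p₀).HasDichotomy a b := ⟨hA.bound_A, hA.bound_B⟩
  have hmem := memCminus_fst_snd_iff (η := η) (ω := ω)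
    (φ := fun t => Real.exp (zInt ω 0 t) • ψ t)
  simp only [exp_neg_smul_exp_smul] at hmem
  obtain ⟨h1, h2⟩ := hmem.2
    ⟨((Real.continuous_exp.comp (continuous_zInt hz)).smul hψ.cont).continuousOn, hψ.decays⟩
  have hrhs := fun t => lp_rhs_eq hz p₀ u₀ (fun t => Real.exp (zInt ω 0 t) • ψ t) t (S := S)
  simp only [exp_neg_smul_exp_smul] at hrhs
  refine ⟨h1, h2, fun t _ => ?_, fun t ht => ?_, fun t ht => ?_, fun t ht => ?_⟩
  · simp only [integrand_u_eq hz, exp_neg_smul_exp_smul]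
    exact (((tame_exp_sub_apply _ (hT.tame_h hψ.cont) t)).intervalIntegrable _ _).smul (Real.exp (zInt ω 0 t))
  · simp only [integrand_v_eq hz, exp_neg_smul_exp_smul]
    exact Integrable.smul (Real.exp (zInt ω 0 t)) (hT.integrableOn_lp hd hbη hψ.cont hψ.decays ht)
  · exact (congrArg (fun x => (Real.exp (zInt ω 0 t) • x).1) (hψ.eq t ht)).trans
      (congrArg Prod.fst (hrhs t)).symm
  · exact (congrArg (fun x => (Real.exp (zInt ω 0 t) • x).2) (hψ.eq t ht)).trans
      (congrArg Prod.snd (hrhs t)).symm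

/-! ### The fibers over a fixed path -/

section Fixed

variable {a b : ℝ} (hS : S.LipschitzCond K) (hz : Tame fun t => z (shift t ω))
  (hA : S.Dichotomy a b) (hbη : b < η) (hηa : η < a)
  (hgap : K * (1 / (η - b) + 1 / (a - η)) < 1)
include hS hz hA hbη hηa hgap

theorem exists_isLPSolution (p₀ : E n × E m) (u₀ : E n) : ∃ φ, S.IsLPSolution η ω p₀ u₀ φ := by
  have hT := (hS.transformed hz).diff (tflow_isOrbitOn hS hz p₀).cont
  obtain ⟨ψ, hψ⟩ := hT.exists_isLP ⟨hA.bound_A, hA.bound_B⟩ hbη hηa hgap u₀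
  exact ⟨_, isLPSolution_of_isLP hS hz hA hbη hψ⟩

theorem isLPSolution_eqOn {p₀ : E n × E m} {u₀ : E n} {φ ψ : ℝ → E n × E m}
    (hφ : S.IsLPSolution η ω p₀ u₀ φ) (hψ : S.IsLPSolution η ω p₀ u₀ ψ) :
    EqOn φ ψ (Iic 0) := by
  intro t ht
  have hT := (hS.transformed hz).diff (tflow_isOrbitOn hS hz p₀).cont
  have h := (hφ.isLP hz).eqOn hT ⟨hA.bound_A, hA.bound_B⟩ hbη hηa hgap (hψ.isLP hz) ht
  simp only [min_eq_left (mem_Iic.1 ht)] at h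
  rw [← exp_smul_exp_neg_smul (zInt ω 0 t) (φ t), h, exp_smul_exp_neg_smul]

/-- Uniqueness on `(-∞, 0]` makes `l` independent of the choice in `lpSolution`; the integral in `l`
is the `v`-equation at time `0`. -/
theorem l_eq_of_isLP {p₀ : E n × E m} {ξ : E n} {ψ : ℝ → E n × E m}
    (hψ : (S.diffSystem ω p₀).IsLP η (ξ - p₀.1) ψ) : S.l η ξ p₀ ω = p₀.2 + (ψ 0).2 := by
  have hT := (hS.transformed hz).diff (tflow_isOrbitOn hS hz p₀).cont
  have hsol : S.IsLPSolution η ω p₀ (ξ - p₀.1) (S.lpSolution η ω p₀ (ξ - p₀.1)) :=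
    Classical.epsilon_spec (exists_isLPSolution hS hz hA hbη hηa hgap p₀ (ξ - p₀.1))
  have h := (hsol.isLP hz).eqOn hT ⟨hA.bound_A, hA.bound_B⟩ hbη hηa hgap hψ
    (mem_Iic.2 (le_refl (0 : ℝ)))
  simp only [min_self, zInt_self, neg_zero, Real.exp_zero, one_smul] at h
  rw [← h, hsol.eq_v 0 le_rfl]
  simp only [zero_sub]
  rfl

/-- A decaying difference of orbits solves the Lyapunov–Perron system, so `l` determines its second
component at `0`. Conversely, the Lyapunov–Perron solution plus the reference orbit is an orbit on
`(-∞, 0]` through `q₀`, hence the orbit of `q₀` by uniqueness. -/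
theorem mem_fiber_iff_eq_l {p₀ q₀ : E n × E m} :
    q₀ ∈ S.fiber η p₀ ω ↔ q₀ = (q₀.1, S.l η q₀.1 p₀ ω) := by
  have hT := hS.transformed hz
  have hp := tflow_isOrbitOn hS hz p₀
  have hq := tflow_isOrbitOn hS hz q₀
  have hTd := hT.diff hp.cont
  have hd : (S.diffSystem ω p₀).HasDichotomy a b := ⟨hA.bound_A, hA.bound_B⟩
  rw [mem_fiber_iff hS hz]
  constructor
  · intro hdec
    have hLP := ((hp.sub hT hq).mono (subset_univ (Iic 0))).isLP hTd hd hbη hdec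
    simp only [tflow_zero hS hz, Prod.fst_sub] at hLP
    have := l_eq_of_isLP hS hz hA hbη hηa hgap hLP
    rw [tflow_zero hS hz, tflow_zero hS hz, Prod.snd_sub, add_sub_cancel] at this
    rw [this]
  · intro hql
    obtain ⟨ψ, hψ⟩ := hTd.exists_isLP hd hbη hηa hgap (q₀.1 - p₀.1)
    have hl := l_eq_of_isLP hS hz hA hbη hηa hgap hψ
    have horb := (hp.mono (subset_univ (Iic 0))).add_of_diff hT (hψ.isOrbitOn hTd hd hbη)
    have h0 : ψ 0 + S.tflow ω p₀ 0 = S.tflow ω q₀ 0 := by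
      rw [tflow_zero hS hz, tflow_zero hS hz]
      refine Prod.ext ?_ ?_
      · rw [Prod.fst_add, hψ.fst_zero, sub_add_cancel]
      · rw [Prod.snd_add, add_comm, ← hl]
        exact (congrArg Prod.snd hql).symm
    have heq := horb.eqOn hT (fun t ht => by
      rw [uIcc_of_ge ht]; exact fun s hs => hs.2) (hq.mono (subset_univ (Iic 0))) h0
    refine hψ.decays.congr fun t ht => ?_
    rw [← heq ht, add_sub_cancel_right]

theorem norm_l_sub_l_le (p₀ : E n × E m) (ξ ξ' : E n) :
    ‖S.l η ξ p₀ ω - S.l η ξ' p₀ ω‖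
      ≤ K / ((η - b) * (1 - K * (1 / (η - b) + 1 / (a - η)))) * ‖ξ - ξ'‖ := by
  have hTd := (hS.transformed hz).diff (tflow_isOrbitOn hS hz p₀).cont
  have hd : (S.diffSystem ω p₀).HasDichotomy a b := ⟨hA.bound_A, hA.bound_B⟩
  obtain ⟨φ, hφ⟩ := hTd.exists_isLP hd hbη hηa hgap (ξ - p₀.1)
  obtain ⟨ψ, hψ⟩ := hTd.exists_isLP hd hbη hηa hgap (ξ' - p₀.1)
  rw [l_eq_of_isLP hS hz hA hbη hηa hgap hφ, l_eq_of_isLP hS hz hA hbη hηa hgap hψ,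
    add_sub_add_left_eq_sub]
  simpa using hφ.norm_snd_zero_sub_le hTd hd hbη hηa hgap hψ

end Fixed

/-! ### Fibers as equivalence classes, and their decay rate -/

theorem mem_fiber_self (hS : S.LipschitzCond K) (hz : Tame fun t => z (shift t ω))
    (p₀ : E n × E m) : p₀ ∈ S.fiber η p₀ ω :=
  (mem_fiber_iff hS hz).2 ⟨0, by simp⟩

theorem mem_fiber_symm (hS : S.LipschitzCond K) (hz : Tame fun t => z (shift t ω))
    {p₀ q₀ : E n × E m} (h : q₀ ∈ S.fiber η p₀ ω) : p₀ ∈ S.fiber η q₀ ω := by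
  rw [mem_fiber_iff hS hz] at h ⊢
  obtain ⟨C, hC⟩ := h
  refine ⟨C, fun t ht => (le_of_eq ?_).trans (hC t ht)⟩
  rw [Prod.fst_sub, Prod.snd_sub, norm_sub_rev, norm_sub_rev (Prod.snd _)]
  rfl

theorem mem_fiber_trans (hS : S.LipschitzCond K) (hz : Tame fun t => z (shift t ω))
    {p₀ q₀ r₀ : E n × E m} (h : q₀ ∈ S.fiber η p₀ ω) (h' : r₀ ∈ S.fiber η q₀ ω) :
    r₀ ∈ S.fiber η p₀ ω := by
  have h2 := mem_fiber_symm hS hz h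
  rw [mem_fiber_iff hS hz] at h' h2 ⊢
  obtain ⟨C, hC⟩ := h'.sub h2
  refine ⟨C, fun t ht => (le_of_eq ?_).trans (hC t ht)⟩
  simp

theorem fiber_eq_of_mem (hS : S.LipschitzCond K) (hz : Tame fun t => z (shift t ω))
    {p₀ q₀ : E n × E m} (h : q₀ ∈ S.fiber η p₀ ω) : S.fiber η q₀ ω = S.fiber η p₀ ω :=
  Subset.antisymm (fun _ hr => mem_fiber_trans hS hz h hr)
    fun _ hr => mem_fiber_trans hS hz (mem_fiber_symm hS hz h) hr

theorem fiber_subset_of_le (hS : S.LipschitzCond K) (hz : Tame fun t => z (shift t ω)) {η' : ℝ}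
    (hη : η ≤ η') (p₀ : E n × E m) : S.fiber η' p₀ ω ⊆ S.fiber η p₀ ω := by
  intro q₀ h
  rw [mem_fiber_iff hS hz] at h ⊢
  obtain ⟨C, hC⟩ := h
  have hC0 : 0 ≤ C := by
    have := (add_nonneg (norm_nonneg _) (norm_nonneg _)).trans (hC 0 le_rfl)
    simpa using this
  refine ⟨C, fun t ht => (hC t ht).trans (mul_le_mul_of_nonneg_left ?_ hC0)⟩
  exact Real.exp_le_exp.2 (mul_le_mul_of_nonpos_right hη ht)

theorem exists_larger_rate {K a b η : ℝ} (hbη : b < η) (hηa : η < a)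
    (hgap : K * (1 / (η - b) + 1 / (a - η)) < 1) :
    ∃ η', η < η' ∧ η' < a ∧ K * (1 / (η' - b) + 1 / (a - η')) < 1 := by
  have hc : ContinuousAt (fun x => K * (1 / (x - b) + 1 / (a - x))) η := by
    have h1 : η - b ≠ 0 := (sub_pos.2 hbη).ne'
    have h2 : a - η ≠ 0 := (sub_pos.2 hηa).ne'
    fun_prop (disch := assumption)
  have h1 : ∀ᶠ x in 𝓝[>] η, K * (1 / (x - b) + 1 / (a - x)) < 1 :=
    (hc.eventually (gt_mem_nhds hgap)).filter_mono nhdsWithin_le_nhds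
  have h2 : ∀ᶠ x in 𝓝[>] η, x ∈ Ioo η a := Ioo_mem_nhdsGT hηa
  obtain ⟨x, hx1, hx2⟩ := (h1.and h2).exists
  exact ⟨x, hx2.1, hx2.2, hx1⟩

theorem isUnstableFiber_fiber (hS : S.LipschitzCond K)
    (hω : Tendsto (fun t : ℝ => ω t / t) atBot (𝓝 0)) {a b : ℝ}
    (hA : S.Dichotomy a b) (hbη : b < η) (hηa : η < a)
    (hgap : K * (1 / (η - b) + 1 / (a - η)) < 1) (p₀ : E n × E m) :
    S.IsUnstableFiber η ω (S.fiber η p₀ ω) := by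
  have hz := tame_z_shift hω
  obtain ⟨η', h1, h2, h3⟩ := exists_larger_rate hbη hηa hgap
  have hfib : S.fiber η p₀ ω ⊆ S.fiber η' p₀ ω := by
    intro q hq
    have hl := (mem_fiber_iff_eq_l hS hz hA hbη hηa hgap).1 hq
    -- The point of the `η'`-fiber above `q.1` also lies in the larger `η`-fiber, whose only point
    -- above `q.1` is `q`.
    have hmem : (q.1, S.l η' q.1 p₀ ω) ∈ S.fiber η' p₀ ω :=
      (mem_fiber_iff_eq_l hS hz hA (hbη.trans h1) h2 h3).2 rfl
    have hl' := (mem_fiber_iff_eq_l hS hz hA hbη hηa hgap).1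
      (fiber_subset_of_le hS hz h1.le p₀ hmem)
    rw [hl, ← hl']
    exact hmem
  intro q hq q' hq'
  have hmem : q' ∈ S.fiber η' q ω :=
    mem_fiber_trans hS hz (mem_fiber_symm hS hz (hfib hq)) (hfib hq')
  obtain ⟨C, hC⟩ := (mem_fiber_iff hS hz).1 (mem_fiber_symm hS hz hmem)
  -- Growth rate exactly `η' - η`: then `∫_0^t z + η' t ≤ D + η t` for `t ≤ 0`.
  obtain ⟨D, hD⟩ := zInt_growth hω (sub_pos.2 h1)
  refine Asymptotics.IsBigO.of_bound (C * Real.exp D) ?_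
  filter_upwards [eventually_le_atBot 0] with t ht
  have hC0 : 0 ≤ C := by
    have := (add_nonneg (norm_nonneg _) (norm_nonneg _)).trans (hC 0 le_rfl)
    simpa using this
  have h4 : ‖S.tflow ω q t - S.tflow ω q' t‖ ≤ C * Real.exp (η' * t) := by
    refine le_trans ?_ (hC t ht)
    exact max_le (le_add_of_nonneg_right (norm_nonneg _)) (le_add_of_nonneg_left (norm_nonneg _))
  have h5 : S.flow t ω q - S.flow t ω q' =
      Real.exp (zInt ω 0 t) • (S.tflow ω q t - S.tflow ω q' t) := by
    simp only [tflow, smul_sub, exp_smul_exp_neg_smul]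
  rw [h5, norm_smul, Real.norm_of_nonneg (Real.exp_nonneg _),
    Real.norm_of_nonneg (Real.exp_nonneg _)]
  refine (mul_le_mul_of_nonneg_left h4 (Real.exp_nonneg _)).trans ?_
  rw [mul_left_comm, ← Real.exp_add, mul_assoc, ← Real.exp_add]
  refine mul_le_mul_of_nonneg_left (Real.exp_le_exp.2 ?_) hC0
  have h6 := (abs_le.1 (hD t ht)).2
  rw [abs_of_nonpos ht] at h6
  linarith

end Data

/-! ### Sublinear growth of stable paths -/

theorem measurableSet_firstPassage {Ω : Type*} {mΩ : MeasurableSpace Ω} {Y : ℕ → Ω → ℝ} {i : ℕ}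
    (hY : ∀ j ≤ i, Measurable (Y j)) (c : ℝ) :
    MeasurableSet {ω | c < |Y i ω| ∧ ∀ j < i, |Y j ω| ≤ c} := by
  have : {ω | c < |Y i ω| ∧ ∀ j < i, |Y j ω| ≤ c} =
      {ω | c < |Y i ω|} ∩ ⋂ j, ⋂ (_ : j < i), {ω | |Y j ω| ≤ c} := by
    ext ω; simp
  rw [this]
  refine (measurableSet_lt measurable_const (hY i le_rfl).abs).inter ?_
  exact MeasurableSet.iInter fun j => MeasurableSet.iInter fun hj =>
    measurableSet_le (hY j hj.le).abs measurable_const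

/-- **Ottaviani's inequality** for sums of independent real random variables. -/
theorem measure_exists_lt_abs_sum_le {Ω : Type*} {mΩ : MeasurableSpace Ω} {μ : Measure Ω}
    [IsProbabilityMeasure μ] {D : ℕ → Ω → ℝ} (hD : iIndepFun D μ) (hm : ∀ i, Measurable (D i))
    {c : ℝ} {N : ℕ}
    (hN : ∀ i ≤ N, μ.real {ω | c < |∑ k ∈ Finset.range N, D k ω - ∑ k ∈ Finset.range i, D k ω|}
      ≤ 1 / 2) :
    μ.real {ω | ∃ i ≤ N, 2 * c < |∑ k ∈ Finset.range i, D k ω|}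
      ≤ 2 * μ.real {ω | c < |∑ k ∈ Finset.range N, D k ω|} := by
  set Y : ℕ → Ω → ℝ := fun i ω => ∑ k ∈ Finset.range i, D k ω with hY
  have hYm : ∀ i, Measurable (Y i) := fun i => Finset.measurable_sum _ fun k _ => hm k
  -- First passage above `2c` at step `i`. If moreover `|Y N - Y i| ≤ c`, the final sum still
  -- exceeds `c`; this second event involves only later summands, so it is independent and has
  -- probability at least `1/2`.
  let A : ℕ → Set Ω := fun i => {ω | 2 * c < |Y i ω| ∧ ∀ j < i, |Y j ω| ≤ 2 * c}
  let B : ℕ → Set Ω := fun i => {ω | |Y N ω - Y i ω| ≤ c}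
  have hA : ∀ i, MeasurableSet (A i) := fun i => measurableSet_firstPassage (fun j _ => hYm j) _
  have hB : ∀ i, MeasurableSet (B i) := fun i =>
    measurableSet_le ((hYm N).sub (hYm i)).abs measurable_const
  have hind : ∀ i ≤ N, μ.real (A i ∩ B i) = μ.real (A i) * μ.real (B i) := by
    intro i hi
    have hI := indep_iSup_of_disjoint (fun k => (hm k).comap_le) hD
      (S := {k | k < i}) (T := {k | i ≤ k})
      (Set.disjoint_left.2 fun k hk hk' => 
        absurd (lt_of_lt_of_le (show k < i from hk) (show i ≤ k from hk')) (lt_irrefl _))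
    have hDS : ∀ k < i, Measurable[⨆ k ∈ {k | k < i}, MeasurableSpace.comap (D k) inferInstance]
        (D k) := fun k hk => (comap_measurable (D k)).mono
      (le_iSup₂ (f := fun k (_ : k ∈ {k | k < i}) => MeasurableSpace.comap (D k) inferInstance) k hk)
      le_rfl
    have hDT : ∀ k, i ≤ k → Measurable[⨆ k ∈ {k | i ≤ k}, MeasurableSpace.comap (D k) inferInstance]
        (D k) := fun k hk => (comap_measurable (D k)).mono
      (le_iSup₂ (f := fun k (_ : k ∈ {k | i ≤ k}) => MeasurableSpace.comap (D k) inferInstance) k hk)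
      le_rfl
    have h1 : MeasurableSet[⨆ k ∈ {k | k < i}, MeasurableSpace.comap (D k) inferInstance] (A i) := by
      refine measurableSet_firstPassage (mΩ := _) (fun j hj => ?_) _
      exact Finset.measurable_sum _ fun k hk =>
        hDS k (lt_of_lt_of_le (Finset.mem_range.1 hk) hj)
    have h2 : MeasurableSet[⨆ k ∈ {k | i ≤ k}, MeasurableSpace.comap (D k) inferInstance] (B i) := by
      have hYY : (fun ω => Y N ω - Y i ω) = fun ω => ∑ k ∈ Finset.Ico i N, D k ω := by
        funext ω
        exact (Finset.sum_Ico_eq_sub (fun k => D k ω) hi).symm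
      have h3 : Measurable[⨆ k ∈ {k | i ≤ k}, MeasurableSpace.comap (D k) inferInstance]
          (fun ω => Y N ω - Y i ω) := by
        rw [hYY]
        exact Finset.measurable_sum _ fun k hk => hDT k (Finset.mem_Ico.1 hk).1
      exact h3 (measurableSet_le (measurable_id.abs) measurable_const : MeasurableSet {x : ℝ | |x| ≤ c})
    have := Indep_iff _ _ μ |>.1 hI _ _ h1 h2
    simp only [measureReal_def, this, ENNReal.toReal_mul]
  have hBhalf : ∀ i ≤ N, 1 / 2 ≤ μ.real (B i) := by
    intro i hi
    have h1 : (B i)ᶜ = {ω | c < |Y N ω - Y i ω|} := by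
      ext ω; simp [B]
    have h2 := probReal_compl_eq_one_sub (μ := μ) (hB i)
    rw [h1] at h2
    have := hN i hi
    simp only [hY] at h2
    linarith
  have hdisj : Set.PairwiseDisjoint (↑(Finset.range (N + 1))) fun i => A i ∩ B i := by
    intro i _ j _ hij
    refine Set.disjoint_left.2 fun ω hi hj => ?_
    rcases lt_or_gt_of_ne hij with h | h
    · exact absurd (hj.1.2 i h) (not_le.2 hi.1.1)
    · exact absurd (hi.1.2 j h) (not_le.2 hj.1.1)
  have hsub1 : {ω | ∃ i ≤ N, 2 * c < |Y i ω|} ⊆ ⋃ i ∈ Finset.range (N + 1), A i := by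
    rintro ω ⟨i, hi, hω⟩
    classical
    have hex : ∃ i, 2 * c < |Y i ω| := ⟨i, hω⟩
    refine mem_iUnion₂.2 ⟨Nat.find hex, ?_, Nat.find_spec hex, fun j hj => ?_⟩
    · exact Finset.mem_range.2 (Nat.lt_succ_of_le ((Nat.find_min' hex hω).trans hi))
    · exact not_lt.1 (Nat.find_min hex hj)
  have hsub2 : ⋃ i ∈ Finset.range (N + 1), A i ∩ B i ⊆ {ω | c < |Y N ω|} := by
    intro ω hω
    obtain ⟨i, -, hA, hB⟩ := mem_iUnion₂.1 hω
    have h1 : 2 * c < |Y i ω| := hA.1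
    have h2 : |Y N ω - Y i ω| ≤ c := hB
    have h3 := abs_sub_abs_le_abs_sub (Y i ω) (Y N ω)
    rw [abs_sub_comm] at h3
    change c < |Y N ω|
    linarith
  calc μ.real {ω | ∃ i ≤ N, 2 * c < |Y i ω|}
      ≤ μ.real (⋃ i ∈ Finset.range (N + 1), A i) := measureReal_mono hsub1 (measure_ne_top _ _)
    _ ≤ ∑ i ∈ Finset.range (N + 1), μ.real (A i) := measureReal_biUnion_finset_le _ _
    _ ≤ ∑ i ∈ Finset.range (N + 1), 2 * μ.real (A i ∩ B i) := by
        refine Finset.sum_le_sum fun i hi => ?_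
        have hi' := Nat.lt_succ_iff.1 (Finset.mem_range.1 hi)
        rw [hind i hi']
        have := hBhalf i hi'
        nlinarith [measureReal_nonneg (μ := μ) (s := A i)]
    _ = 2 * μ.real (⋃ i ∈ Finset.range (N + 1), A i ∩ B i) := by
        rw [← Finset.mul_sum, measureReal_biUnion_finset hdisj fun i _ => (hA i).inter (hB i)]
    _ ≤ _ := mul_le_mul_of_nonneg_left (measureReal_mono hsub2) zero_le_two

/-! ### Maximal inequality for paths -/

theorem measurable_eval (t : ℝ) : Measurable fun ω : PathSpace => ω t :=
  (measurable_pi_apply t).comp (comap_measurable _)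

/-- Maximal inequality for càdlàg paths with independent increments. -/
theorem measure_exists_lt_abs_increment_le {P : Measure PathSpace} [IsProbabilityMeasure P]
    (hP : HasIndepIncrements (fun (t : ℝ) (ω : PathSpace) => ω t) P) {u T c : ℝ} (hT : 0 < T)
    (hhalf : ∀ s ∈ Icc u (u + T), P.real {ω : PathSpace | c < |ω (u + T) - ω s|} ≤ 1 / 2) :
    P {ω : PathSpace | ∃ s ∈ Icc u (u + T), 2 * c < |ω s - ω u|}
      ≤ ENNReal.ofReal (2 * P.real {ω : PathSpace | c < |ω (u + T) - ω u|}) := by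
  -- Exceedance on the dyadic grid of level `n`. By right-continuity the increasing union contains
  -- every exceedance on the interval.
  let G : ℕ → Set PathSpace := fun n =>
    {ω | ∃ j : ℕ, j ≤ 2 ^ n ∧ 2 * c < |ω (u + T * ((j : ℝ) / 2 ^ n)) - ω u|}
  have hGmono : Monotone G := by
    refine monotone_nat_of_le_succ fun n ω => ?_
    rintro ⟨j, hj, h⟩
    refine ⟨2 * j, by rw [pow_succ]; omega, ?_⟩
    have : ((2 * j : ℕ) : ℝ) / 2 ^ (n + 1) = (j : ℝ) / 2 ^ n := by
      push_cast; rw [pow_succ]; field_simp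
    rwa [this]
  have hG : ∀ n, P (G n) ≤ ENNReal.ofReal (2 * P.real {ω : PathSpace | c < |ω (u + T) - ω u|}) := by
    intro n
    -- Capping the index makes an infinite monotone sequence of times that stays at `u + T`, as
    -- Ottaviani's inequality takes a sequence indexed by `ℕ`.
    let τ : ℕ → ℝ := fun j => u + T * (((min j (2 ^ n) : ℕ) : ℝ) / 2 ^ n)
    have hτ : Monotone τ := by
      intro i j hij
      have : ((min i (2 ^ n) : ℕ) : ℝ) ≤ ((min j (2 ^ n) : ℕ) : ℝ) :=
        Nat.cast_le.2 (min_le_min_right _ hij)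
      simp only [τ]
      gcongr
    have hsum : ∀ i (ω : PathSpace),
        ∑ k ∈ Finset.range i, (ω (τ (k + 1)) - ω (τ k)) = ω (τ i) - ω u := by
      intro i ω
      rw [Finset.sum_range_sub (fun k => ω (τ k))]
      simp [τ]
    have hτN : τ (2 ^ n) = u + T := by simp [τ]
    have hτmem : ∀ i, τ i ∈ Icc u (u + T) := by
      intro i
      refine ⟨?_, ?_⟩
      · simp only [τ]
        have : 0 ≤ T * (((min i (2 ^ n) : ℕ) : ℝ) / 2 ^ n) := by positivity
        linarith
      · simp only [τ]
        have h1 : ((min i (2 ^ n) : ℕ) : ℝ) / 2 ^ n ≤ 1 := by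
          rw [div_le_one (by positivity)]
          exact_mod_cast min_le_right i (2 ^ n)
        nlinarith
    have hO := measure_exists_lt_abs_sum_le (hP.nat hτ)
      (fun i => (measurable_eval _).sub (measurable_eval _)) (c := c) (N := 2 ^ n) (by
        intro i _
        simp only [hsum, hτN, sub_sub_sub_cancel_right]
        exact hhalf _ (hτmem i))
    simp only [hsum, hτN] at hO
    have hGe : G n = {ω : PathSpace | ∃ i : ℕ, i ≤ 2 ^ n ∧ 2 * c < |ω (τ i) - ω u|} := by
      ext ω
      refine exists_congr fun j => and_congr_right fun hj => ?_
      simp only [τ, min_eq_left hj]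
    rw [← ofReal_measureReal, hGe]
    exact ENNReal.ofReal_le_ofReal hO
  refine (measure_mono (t := ⋃ n, G n) ?_).trans ?_
  · rintro ω ⟨s, ⟨hs1, hs2⟩, hs⟩
    rcases hs2.eq_or_lt with rfl | hlt
    · refine mem_iUnion.2 ⟨0, 1, by simp, by simpa using hs⟩
    · have hrc := ((ω.2.1 s).1.sub (continuousWithinAt_const (b := ω u))).abs
      have hev : ∀ᶠ r in 𝓝[Ici s] s, 2 * c < |ω r - ω u| := hrc.eventually (lt_mem_nhds hs)
      rw [eventually_nhdsWithin_iff] at hev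
      obtain ⟨δ, hδ, hball⟩ := Metric.eventually_nhds_iff.1 hev
      -- The mesh must be so fine that the first grid point at or after `s` is within `δ` of `s` and
      -- does not pass `u + T`.
      obtain ⟨n, hn⟩ : ∃ n : ℕ, T * (1 / 2) ^ n < min δ (u + T - s) := by
        have h1 : Tendsto (fun n : ℕ => T * (1 / 2 : ℝ) ^ n) atTop (𝓝 (T * 0)) :=
          tendsto_const_nhds.mul
            (tendsto_pow_atTop_nhds_zero_of_lt_one (by norm_num) (by norm_num))
        rw [mul_zero] at h1
        exact (h1.eventually (gt_mem_nhds (lt_min hδ (by linarith)))).exists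
      have h2n : (0 : ℝ) < 2 ^ n := by positivity
      have hx0 : 0 ≤ (s - u) / T * 2 ^ n := by
        have := sub_nonneg.2 hs1; positivity
      set j := ⌈(s - u) / T * 2 ^ n⌉₊ with hj
      have hj1 : (s - u) / T * 2 ^ n ≤ j := Nat.le_ceil _
      have hj2 : (j : ℝ) < (s - u) / T * 2 ^ n + 1 := Nat.ceil_lt_add_one hx0
      have hpow : T * (1 / 2) ^ n = T / 2 ^ n := by rw [one_div, inv_pow]; rfl
      rw [hpow] at hn
      have hge : s ≤ u + T * ((j : ℝ) / 2 ^ n) := by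
        have : T * (((s - u) / T * 2 ^ n) / 2 ^ n) ≤ T * ((j : ℝ) / 2 ^ n) := by gcongr
        have h3 : T * (((s - u) / T * 2 ^ n) / 2 ^ n) = s - u := by field_simp
        linarith
      have hlt' : u + T * ((j : ℝ) / 2 ^ n) < s + T / 2 ^ n := by
        have : T * ((j : ℝ) / 2 ^ n) < T * (((s - u) / T * 2 ^ n + 1) / 2 ^ n) := by gcongr
        have h3 : T * (((s - u) / T * 2 ^ n + 1) / 2 ^ n) = s - u + T / 2 ^ n := by field_simp
        linarith
      refine mem_iUnion.2 ⟨n, j, ?_, ?_⟩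
      · have h4 : T * ((j : ℝ) / 2 ^ n) < T * 1 := by
          have := hn.trans_le (min_le_right _ _)
          linarith
        have h5 := lt_of_mul_lt_mul_left h4 hT.le
        rw [div_lt_one h2n] at h5
        exact_mod_cast h5.le
      · refine hball ?_ hge
        rw [Real.dist_eq, abs_of_nonneg (by linarith)]
        have := hn.trans_le (min_le_left _ _)
        linarith
  · rw [hGmono.measure_iUnion]
    exact iSup_le hG

/-! ### Tail bounds, Borel–Cantelli and sublinear growth -/

theorem IsStableLevyLaw.measure_lt_abs_increment_le {α d : ℝ} (hα₀ : 0 < α) (hα₂ : α < 2)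
    (hd : 0 ≤ d) {P : Measure PathSpace} (hP : IsStableLevyLaw α d P) {s t c : ℝ} (hst : s ≤ t)
    (hc : 2 ≤ c) :
    P.real {ω : PathSpace | c < |ω t - ω s|} ≤ (d + 2) * (t - s) * (2 / c) ^ α := by
  have := hP.prob
  have hm : Measurable fun ω : PathSpace => ω t - ω s := (measurable_eval t).sub (measurable_eval s)
  have := Measure.isProbabilityMeasure_map (μ := P) hm.aemeasurable
  have hc0 : 0 < c := by linarith
  have h1 := measureReal_abs_gt_le_integral_charFun (μ := P.map fun ω : PathSpace => ω t - ω s) hc0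
  have hms : MeasurableSet {x : ℝ | c < |x|} := measurableSet_lt measurable_const measurable_id.abs
  rw [map_measureReal_apply hm hms] at h1
  refine h1.trans ?_
  have h2 : 2 / c ≤ 1 := by rw [div_le_one hc0]; exact hc
  have h2' : 0 < 2 / c := by positivity
  have hbound : ∀ u ∈ uIoc (-2 * c⁻¹) (2 * c⁻¹),
      ‖1 - charFun (P.map fun ω : PathSpace => ω t - ω s) u‖
        ≤ (t - s) * ((d / 2 + 1) * (2 / c) ^ α) := by
    intro u hu
    have hu' : |u| ≤ 2 / c := by
      rw [uIoc_of_le (by have := inv_pos.2 hc0; linarith)] at hu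
      rw [abs_le, div_eq_mul_inv]
      exact ⟨by linarith [hu.1], hu.2⟩
    rw [hP.law s t hst u, ← Complex.ofReal_exp, ← Complex.ofReal_one, ← Complex.ofReal_sub,
      Complex.norm_real, Real.norm_eq_abs]
    have hψ0 : 0 ≤ d * u ^ 2 / 2 + |u| ^ α := by positivity
    -- As `|u| ≤ 2/c ≤ 1` and `α < 2`, the Gaussian part is dominated by the stable power. The
    -- prefactor `c/2` of the truncation inequality times the length `4/c` gives `2 (d/2 + 1) = d +
    -- 2`.
    have hψ : d * u ^ 2 / 2 + |u| ^ α ≤ (d / 2 + 1) * (2 / c) ^ α := by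
      have h3 : |u| ^ α ≤ (2 / c) ^ α := Real.rpow_le_rpow (abs_nonneg _) hu' hα₀.le
      have h4 : u ^ 2 ≤ (2 / c) ^ α := by
        rw [← sq_abs]
        refine (pow_le_pow_left₀ (abs_nonneg _) hu' 2).trans ?_
        rw [← Real.rpow_natCast]
        exact Real.rpow_le_rpow_of_exponent_ge h2' h2 (by exact_mod_cast hα₂.le)
      nlinarith
    have hts := sub_nonneg.2 hst
    have h5 : Real.exp (-(t - s) * (d * u ^ 2 / 2 + |u| ^ α)) ≤ 1 := by
      rw [Real.exp_le_one_iff, neg_mul]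
      exact neg_nonpos.2 (mul_nonneg hts hψ0)
    rw [abs_of_nonneg (sub_nonneg.2 h5)]
    have h6 := Real.add_one_le_exp (-(t - s) * (d * u ^ 2 / 2 + |u| ^ α))
    have h7 := mul_le_mul_of_nonneg_left hψ hts
    linarith
  have h3 := intervalIntegral.norm_integral_le_of_norm_le_const hbound
  have h4 : |2 * c⁻¹ - -2 * c⁻¹| = 4 * c⁻¹ := by
    rw [abs_of_nonneg (by have := inv_pos.2 hc0; linarith)]; ring
  rw [h4] at h3
  refine (mul_le_mul_of_nonneg_left h3 (by positivity)).trans_eq ?_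
  field_simp
  ring

theorem IsStableLevyLaw.ae_eventually_abs_increment_le {α d : ℝ} (hα₁ : 1 < α) (hα₂ : α < 2)
    (hd : 0 ≤ d) {P : Measure PathSpace} (hP : IsStableLevyLaw α d P) {ε : ℝ} (hε : 0 < ε)
    (u : ℕ → ℝ) :
    ∀ᵐ ω : PathSpace ∂P, ∀ᶠ k : ℕ in atTop, ∀ s ∈ Icc (u k) (u k + 2 ^ k),
      |ω s - ω (u k)| ≤ 2 * (ε * 2 ^ k) := by
  have := hP.prob
  set C := (d + 2) * (2 / ε) ^ α with hC
  -- Time `2^k` contributes `2^k` and level `ε 2^k` contributes `2^{-αk}`; the ratio is below `1`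
  -- exactly because `α > 1`.
  set r : ℝ := 2 ^ (1 - α) with hr
  have hC0 : 0 ≤ C := by positivity
  have hr0 : 0 ≤ r := by positivity
  have hr1 : r < 1 := Real.rpow_lt_one_of_one_lt_of_neg one_lt_two (by linarith)
  have hCr : ∀ k : ℕ, (d + 2) * 2 ^ k * (2 / (ε * 2 ^ k)) ^ α = C * r ^ k := by
    intro k
    have h1 : (2 / (ε * 2 ^ k)) ^ α = (2 / ε) ^ α * ((2 : ℝ) ^ (-α)) ^ k := by
      rw [← div_div, div_eq_mul_inv (2 / ε), Real.mul_rpow (by positivity) (by positivity),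
        Real.inv_rpow (by positivity), ← Real.rpow_natCast, ← Real.rpow_natCast,
        ← Real.rpow_mul zero_le_two, ← Real.rpow_mul zero_le_two, ← Real.rpow_neg zero_le_two]
      ring_nf
    have h2 : r = 2 * (2 : ℝ) ^ (-α) := by
      rw [hr, sub_eq_add_neg, Real.rpow_add two_pos, Real.rpow_one]
    rw [h1, h2, mul_pow, hC]
    ring
  have hlarge : ∀ᶠ k : ℕ in atTop, 2 ≤ ε * 2 ^ k ∧ C * r ^ k ≤ 1 / 2 := by
    have h1 : Tendsto (fun k : ℕ => ε * (2 : ℝ) ^ k) atTop atTop :=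
      (tendsto_pow_atTop_atTop_of_one_lt one_lt_two).const_mul_atTop hε
    have h2 : Tendsto (fun k : ℕ => C * r ^ k) atTop (𝓝 (C * 0)) :=
      (tendsto_pow_atTop_nhds_zero_of_lt_one hr0 hr1).const_mul C
    rw [mul_zero] at h2
    exact (h1.eventually_ge_atTop 2).and
      ((h2.eventually (gt_mem_nhds (by norm_num : (0 : ℝ) < 1 / 2))).mono fun _ h => h.le)
  obtain ⟨k₀, hk₀⟩ := eventually_atTop.1 hlarge
  let B : ℕ → Set PathSpace := fun k =>
    {ω | ∃ s ∈ Icc (u k) (u k + 2 ^ k), 2 * (ε * 2 ^ k) < |ω s - ω (u k)|}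
  have hB : ∀ k, P (B (k + k₀)) ≤ ENNReal.ofReal (2 * (C * r ^ (k + k₀))) := by
    intro k
    obtain ⟨hk1, hk2⟩ := hk₀ (k + k₀) (Nat.le_add_left _ _)
    have htail : ∀ s ∈ Icc (u (k + k₀)) (u (k + k₀) + 2 ^ (k + k₀)),
        P.real {ω : PathSpace | ε * 2 ^ (k + k₀) < |ω (u (k + k₀) + 2 ^ (k + k₀)) - ω s|}
          ≤ C * r ^ (k + k₀) := by
      intro s hs
      refine (hP.measure_lt_abs_increment_le (by linarith) hα₂ hd hs.2 hk1).trans ?_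
      rw [← hCr]
      have : u (k + k₀) + 2 ^ (k + k₀) - s ≤ 2 ^ (k + k₀) := by linarith [hs.1]
      gcongr
    refine (measure_exists_lt_abs_increment_le hP.indep (by positivity)
      fun s hs => (htail s hs).trans hk2).trans (ENNReal.ofReal_le_ofReal ?_)
    exact mul_le_mul_of_nonneg_left
      (htail _ ⟨le_rfl, by have : (0 : ℝ) < 2 ^ (k + k₀) := by positivity
                           linarith⟩) zero_le_two
  have hsum : ∑' k, P (B (k + k₀)) ≠ ⊤ := by
    have hs : Summable fun k => 2 * (C * r ^ (k + k₀)) := by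
      simp only [pow_add]
      exact (((summable_geometric_of_lt_one hr0 hr1).mul_right _).mul_left _).mul_left _
    exact ne_top_of_le_ne_top hs.tsum_ofReal_ne_top (ENNReal.tsum_le_tsum hB)
  filter_upwards [ae_eventually_notMem hsum] with ω hω
  obtain ⟨k₁, hk₁⟩ := eventually_atTop.1 hω
  filter_upwards [eventually_ge_atTop (k₁ + k₀)] with k hk s hs
  have h := hk₁ (k - k₀) (by omega)
  rw [Nat.sub_add_cancel (by omega)] at h
  by_contra hcon
  exact h ⟨s, hs, not_le.1 hcon⟩

theorem tendsto_div_atTop_of_dyadic {w : ℝ → ℝ}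
    (h : ∀ j : ℕ, ∀ᶠ k : ℕ in atTop, ∀ s ∈ Icc (0 : ℝ) (2 ^ k), |w s| ≤ 4 * (1 / ((j : ℝ) + 1) * 2 ^ k)) :
    Tendsto (fun t => w t / t) atTop (𝓝 0) := by
  rw [Metric.tendsto_nhds]
  intro ε hε
  -- `8` is the `4` of the hypothesis times the loss `2^{k+1} ≤ 2t` from rounding `t` up to a power
  -- of two.
  obtain ⟨j, hj⟩ := exists_nat_one_div_lt (show (0 : ℝ) < ε / 8 by positivity)
  obtain ⟨k₁, hk₁⟩ := eventually_atTop.1 (h j)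
  filter_upwards [eventually_ge_atTop ((2 : ℝ) ^ k₁), eventually_ge_atTop 1] with t ht ht1
  obtain ⟨k, hk1, hk2⟩ := exists_nat_pow_near ht1 one_lt_two
  have hkk : k₁ ≤ k + 1 :=
    ((pow_lt_pow_iff_right₀ (one_lt_two (α := ℝ))).1 (ht.trans_lt hk2)).le
  have ht0 : 0 < t := by linarith
  have h1 := hk₁ (k + 1) hkk t ⟨ht0.le, hk2.le⟩
  rw [Real.dist_eq, sub_zero, abs_div, abs_of_pos ht0, div_lt_iff₀ ht0]
  refine h1.trans_lt ?_
  have h2 : (2 : ℝ) ^ (k + 1) ≤ 2 * t := by rw [pow_succ]; linarith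
  have h3 : 0 ≤ 1 / ((j : ℝ) + 1) := by positivity
  nlinarith

theorem IsStableLevyLaw.ae_mem_Omega {α d : ℝ} (hα₁ : 1 < α) (hα₂ : α < 2)
    (hd : 0 ≤ d) {P : Measure PathSpace} (hP : IsStableLevyLaw α d P) :
    ∀ᵐ ω ∂P, ω ∈ Omega := by
  have hpos : ∀ j : ℕ, (0 : ℝ) < 1 / ((j : ℝ) + 1) := fun j => by positivity
  have h1 := ae_all_iff.2 fun j : ℕ =>
    hP.ae_eventually_abs_increment_le hα₁ hα₂ hd (hpos j) fun _ => 0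
  have h2 := ae_all_iff.2 fun j : ℕ =>
    hP.ae_eventually_abs_increment_le hα₁ hα₂ hd (hpos j) fun k => -2 ^ k
  filter_upwards [h1, h2] with ω hω1 hω2
  have hω0 : ω 0 = 0 := ω.2.2
  refine ⟨tendsto_div_atTop_of_dyadic fun j => ?_, ?_⟩
  · filter_upwards [hω1 j] with k hk s hs
    have := hk s (by simpa using hs)
    rw [hω0, sub_zero] at this
    have h3 : 0 ≤ 1 / ((j : ℝ) + 1) * 2 ^ k := by positivity
    linarith
  · have h3 : Tendsto (fun t => (fun s => -ω (-s)) t / t) atTop (𝓝 0) := by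
      refine tendsto_div_atTop_of_dyadic fun j => ?_
      filter_upwards [hω2 j] with k hk s hs
      -- On `[-2^k, 0]` the block starts at `-2^k`, so both `ω(-s)` and `ω(0) = 0` are compared with
      -- `ω(-2^k)`; the two errors add up to the factor `4`.
      have h4 := hk (-s) ⟨by linarith [hs.2], by linarith [hs.1]⟩
      have h5 := hk 0 ⟨by linarith [hs.1, hs.2], by simp⟩
      rw [hω0] at h5
      rw [abs_neg]
      have h6 := abs_sub_abs_le_abs_sub (ω (-s)) (ω (-2 ^ k))
      rw [zero_sub, abs_neg] at h5
      linarith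
    have h4 := h3.comp tendsto_neg_atBot_atTop
    refine h4.congr fun t => ?_
    simp

/-! ### Invariance under the shift -/

/-- Write `(ω(s+t) - ω(t))/s` as `ω(s+t)/(s+t) · (1 + t/s) - ω(t)/s`. -/
theorem tendsto_shift_div {ω : PathSpace} {l : Filter ℝ} (t : ℝ) (hl : Tendsto (fun s => s + t) l l)
    (hinv : Tendsto (fun s : ℝ => s⁻¹) l (𝓝 0)) (h0 : ∀ᶠ s in l, s ≠ 0)
    (hω : Tendsto (fun s : ℝ => ω s / s) l (𝓝 0)) :
    Tendsto (fun s : ℝ => shift t ω s / s) l (𝓝 0) := by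
  have h1 : Tendsto (fun s => ω (s + t) / (s + t) * (1 + t * s⁻¹) - ω t * s⁻¹) l
      (𝓝 (0 * (1 + t * 0) - ω t * 0)) :=
    ((hω.comp hl).mul ((hinv.const_mul t).const_add 1)).sub (hinv.const_mul _)
  simp only [zero_mul, mul_zero, sub_zero] at h1
  refine h1.congr' ?_
  filter_upwards [h0, hl.eventually h0] with s hs hst
  change _ = (ω (s + t) - ω t) / s
  field_simp

theorem shift_mem_Omega {ω : PathSpace} (hω : ω ∈ Omega) (t : ℝ) : shift t ω ∈ Omega :=
  ⟨tendsto_shift_div t (tendsto_atTop_add_const_right _ _ tendsto_id) tendsto_inv_atTop_zero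
    (eventually_ne_atTop 0) hω.1,
  tendsto_shift_div t (tendsto_atBot_add_const_right _ _ tendsto_id) tendsto_inv_atBot_zero
    (eventually_ne_atBot 0) hω.2⟩

theorem shift_shift_neg (ω : PathSpace) (t : ℝ) : shift t (shift (-t) ω) = ω := by
  refine Subtype.ext (funext fun s => ?_)
  change (ω (s + t + -t) - ω (-t)) - (ω (t + -t) - ω (-t)) = ω s
  have : ω 0 = 0 := ω.2.2
  simp [this]

theorem shift_image_Omega (t : ℝ) : shift t '' Omega = Omega := by
  refine Subset.antisymm ?_ fun ω hω => ⟨shift (-t) ω, shift_mem_Omega hω _, shift_shift_neg ω t⟩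
  rintro _ ⟨ω, hω, rfl⟩
  exact shift_mem_Omega hω t

end LevyFoliation

end

/-! ### The unstable foliation -/

theorem theorem4p1 {n m : ℕ} (S : LevyFoliation.Data n m) (a b K η : ℝ)
    (hA1 : S.Dichotomy a b) (hA2 : S.LipschitzCond K)
    (hη_pos : 0 < η) (hη_lt : η < a)
    (hgap : K * (1 / (η - b) + 1 / (a - η)) < 1)
    (α d : ℝ) (hα₁ : 1 < α) (hα₂ : α < 2) (hd : 0 ≤ d)
    (P : Measure LevyFoliation.PathSpace) (hP : LevyFoliation.IsStableLevyLaw α d P) :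
    -- `Ω` is a shift-invariant set of full measure
    (∀ t : ℝ, LevyFoliation.shift t '' LevyFoliation.Omega = LevyFoliation.Omega) ∧
    (∀ᵐ ω ∂P, ω ∈ LevyFoliation.Omega) ∧
    ∀ ω ∈ LevyFoliation.Omega,
      -- the random system has a unique global solution for every initial value
      (∀ p₀ : LevyFoliation.E n × LevyFoliation.E m, ∃! p, S.IsSolution ω p₀ p) ∧
      -- the fibers form a partition of the state space into `η`-unstable fibers
      (∀ p₀ : LevyFoliation.E n × LevyFoliation.E m, p₀ ∈ S.fiber η p₀ ω) ∧
      (∀ p₀ q₀ : LevyFoliation.E n × LevyFoliation.E m,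
        q₀ ∈ S.fiber η p₀ ω → S.fiber η q₀ ω = S.fiber η p₀ ω) ∧
      (∀ p₀ : LevyFoliation.E n × LevyFoliation.E m,
        S.IsUnstableFiber η ω (S.fiber η p₀ ω)) ∧
      -- the Lyapunov-Perron system that defines `l` is uniquely solvable
      (∀ (p₀ : LevyFoliation.E n × LevyFoliation.E m) (u₀ : LevyFoliation.E n),
        (∃ φ, S.IsLPSolution η ω p₀ u₀ φ) ∧
        ∀ φ ψ, S.IsLPSolution η ω p₀ u₀ φ → S.IsLPSolution η ω p₀ u₀ ψ →
          Set.EqOn φ ψ (Set.Iic 0)) ∧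
      -- every fiber is the graph of `l`, which is Lipschitz with the stated constant
      ∀ p₀ : LevyFoliation.E n × LevyFoliation.E m,
        S.fiber η p₀ ω = {q | ∃ ξ : LevyFoliation.E n, q = (ξ, S.l η ξ p₀ ω)} ∧
        ∀ ξ ξ' : LevyFoliation.E n,
          ‖S.l η ξ p₀ ω - S.l η ξ' p₀ ω‖
            ≤ K / ((η - b) * (1 - K * (1 / (η - b) + 1 / (a - η)))) * ‖ξ - ξ'‖ := by
  have hbη : b < η := hA1.b_neg.trans hη_pos
  refine ⟨LevyFoliation.shift_image_Omega, hP.ae_mem_Omega hα₁ hα₂ hd, fun ω hω => ?_⟩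
  have hz := LevyFoliation.tame_z_shift hω.2
  refine ⟨LevyFoliation.Data.existsUnique_isSolution hA2 hz,
    LevyFoliation.Data.mem_fiber_self hA2 hz,
    fun p₀ q₀ h => LevyFoliation.Data.fiber_eq_of_mem hA2 hz h,
    LevyFoliation.Data.isUnstableFiber_fiber hA2 hω.2 hA1 hbη hη_lt hgap,
    fun p₀ u₀ => ⟨LevyFoliation.Data.exists_isLPSolution hA2 hz hA1 hbη hη_lt hgap p₀ u₀,
      fun φ ψ => LevyFoliation.Data.isLPSolution_eqOn hA2 hz hA1 hbη hη_lt hgap⟩,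
    fun p₀ => ⟨Set.ext fun q => ?_,
      LevyFoliation.Data.norm_l_sub_l_le hA2 hz hA1 hbη hη_lt hgap p₀⟩⟩
  rw [LevyFoliation.Data.mem_fiber_iff_eq_l hA2 hz hA1 hbη hη_lt hgap]
  constructor
  · exact fun h => ⟨q.1, h⟩
  · rintro ⟨ξ, rfl⟩
    rfl
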